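/- **Definitions.** A *logarithmico-exponential (LE) function* is a real-valued function, defined for all sufficiently large $x$, that is obtained from the real constants and the identity $x\mapsto x$ by finitely many applications of $+,-,\times,\div$ (with ultimately nonvanishing denominator), $\exp$, and $\log$ (of an ultimately positive function). Say that $f:\mathbb R\to\mathbb R$ has LE germs at $\pm\infty$ if there are LE functions $g,h$ such that $f(x)=g(x)$ and $f(-x)=h(x)$ for all sufficiently large $x$. For $\varphi\in L^2(\mathbb R)$ and a finite set $\Lambda\subset(0,\infty)\times\mathbb R$, the *finite wavelet system* generated by $\varphi$ and $\Lambda$ is the family $\big(\varphi(\lambda x-\beta)\big)_{(\lambda,\beta)\in\Lambda}$ in $L^2(\mathbb R)$. Let $\widehat\varphi$ be the ($L^2$-)Fourier transform, normalized by $\widehat\varphi(\gamma)=\int\varphi(x)e^{-2\pi i\gamma x}\,dx$. **Theorem.** Let $\varphi\in L^2(\mathbb R)\setminus\{0\}$ be such that $\widehat\varphi$ is (almost everywhere) a finite linear combination, with complex coefficients, of square-integrable functions $f:\mathbb R\to\mathbb R$ having LE germs at $\pm\infty$. Then every finite wavelet system generated by $\varphi$ is linearly independent over $\mathbb C$ in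 $L^2(\mathbb R)$. Moreover, every finite wavelet system generated by $\varphi$ is linearly independent over $\mathbb C$ in $L^2(\mathbb R)$ in each of the following cases: $\varphi$ is a nonzero square-integrable rational function (with complex coefficients); $\varphi(x)=e^{-n|x|}$ for an integer $n\ge1$; $\varphi(x)=e^{-x^2}$ (the last two being square-integrable). -/

import Mathlib

open MeasureTheory Filter FourierTransform

/-- Logarithmico-exponential functions: real functions obtained near `+∞` from the real constants
and the identity by finitely many arithmetic operations, exponentials and logarithms. A quotient
needs an ultimately nonvanishing denominator, a logarithm an ultimately positive argument; the
values before that are immaterial, since only germs at `+∞` are used (see `HasLEGerm`). -/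
inductive IsLogExp : (ℝ → ℝ) → Prop
  | const (c : ℝ) : IsLogExp fun _ => c
  | id : IsLogExp fun x => x
  | add {f g : ℝ → ℝ} (hf : IsLogExp f) (hg : IsLogExp g) : IsLogExp fun x => f x + g x
  | sub {f g : ℝ → ℝ} (hf : IsLogExp f) (hg : IsLogExp g) : IsLogExp fun x => f x - g x
  | mul {f g : ℝ → ℝ} (hf : IsLogExp f) (hg : IsLogExp g) : IsLogExp fun x => f x * g x
  | div {f g : ℝ → ℝ} (hf : IsLogExp f) (hg : IsLogExp g) (h0 : ∀ᶠ x in atTop, g x ≠ 0) :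
      IsLogExp fun x => f x / g x
  | exp {f : ℝ → ℝ} (hf : IsLogExp f) : IsLogExp fun x => Real.exp (f x)
  | log {f : ℝ → ℝ} (hf : IsLogExp f) (h0 : ∀ᶠ x in atTop, 0 < f x) :
      IsLogExp fun x => Real.log (f x)

/-- The germ of `f` at `+∞` is the germ of a logarithmico-exponential function. -/
def HasLEGerm (f : ℝ → ℝ) : Prop :=
  ∃ g : ℝ → ℝ, IsLogExp g ∧ f =ᶠ[atTop] g

/-- `F` is almost everywhere a complex linear combination of square-integrable real functions
`f j` such that the germs at `+∞` of both `f j` and `x ↦ f j (-x)` are logarithmico-exponential. -/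
def IsLECombination (F : ℝ → ℂ) : Prop :=
  ∃ (m : ℕ) (a : Fin m → ℂ) (f : Fin m → ℝ → ℝ),
    (∀ j, MemLp (f j) 2 volume ∧ HasLEGerm (f j) ∧ HasLEGerm fun x => f j (-x)) ∧
    F =ᵐ[volume] fun x => ∑ j, a j * (f j x : ℂ)

theorem memLp_dilate_translate {φ : ℝ → ℂ} (hφ : MemLp φ 2 volume) {r : ℝ} (hr : 0 < r) (b : ℝ) :
    MemLp (fun x => φ (r * x - b)) 2 volume := by
  have hm : Measure.map (fun x : ℝ => r * x - b) volume = ENNReal.ofReal |r⁻¹| • volume := by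
    have h : (fun x : ℝ => r * x - b) = (fun x => x - b) ∘ (fun x => r * x) := rfl
    rw [h, ← Measure.map_map (by fun_prop) (by fun_prop), Real.map_volume_mul_left hr.ne',
      Measure.map_smul, (measurePreserving_sub_right volume b).map_eq]
  refine MemLp.comp_of_map (f := fun x : ℝ => r * x - b) (g := φ) ?_ (by fun_prop)
  rw [hm]
  exact hφ.smul_measure ENNReal.ofReal_ne_top

/-- The element `x ↦ φ (r x - b)` of `L²(ℝ)`, for `s = (r, b)` in `(0, ∞) × ℝ`. -/
noncomputable def waveletAtom (φ : Lp ℂ 2 (volume : Measure ℝ)) (s : Set.Ioi (0 : ℝ) × ℝ) :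
    Lp ℂ 2 (volume : Measure ℝ) :=
  (memLp_dilate_translate (Lp.memLp φ) s.1.2 s.2).toLp fun x => φ ((s.1 : ℝ) * x - s.2)

/-- Every finite wavelet system generated by `φ` is linearly independent in `L²(ℝ)` over `ℂ`. -/
def FiniteWaveletSystemsIndependent (φ : Lp ℂ 2 (volume : Measure ℝ)) : Prop :=
  ∀ Λ : Finset (Set.Ioi (0 : ℝ) × ℝ), LinearIndependent ℂ fun s : Λ => waveletAtom φ s

/-! Let `F` be the Fourier transform of `φ`. A linear relation between wavelets becomes `∑ c s / r *
exp (-2πi b γ / r) * F (γ / r) = 0` almost everywhere, with `s = (r, b)`. Grouping by frequency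
gives `∑ ω, exp (i ω γ) * A ω γ = 0`, where each `A ω` is a combination of dilates of `F`.

Near `+∞` the real and imaginary parts of the `A ω` are LE functions. Finitely many of these lie in
one Hardy field, where any two germs are comparable in size and bounded germs converge. Dividing by
a dominant germ leaves a trigonometric polynomial tending to zero with a nonzero coefficient, which
is impossible. Hence every `A ω` vanishes near `+∞` (`eventually_eq_zero_of_sum_exp`).

With `γ = exp t` dilations become translations, and `G t = F (exp t)` satisfies several
constant-coefficient translation equations near `+∞`. The main difficulty is to carry one of them to
all `t` (`ae_eq_zero_of_sum_exp_translate`). The recursion for one frequency extends `G` downwards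
to a function `H`; commuting translation operators give `H` the equations of all other frequencies,
and the original mixed relation then forces `G = H` almost everywhere. Since `exp (t / 2) * G t` is
square-integrable and translates of a nonzero `L²` function are independent, `G = 0`. Reflection
treats the negative half-line.

For a rational `φ` no transform is needed: an extremal pole of one wavelet cannot be cancelled by
the others. The remaining two examples have explicit even LE Fourier transforms. -/

/-! ### Differentiation of germs at `+∞` -/

/-- `b` is the germ at `+∞` of a derivative of a function with germ `a`. -/
def GermHasDeriv (a b : Germ (atTop : Filter ℝ) ℝ) : Prop :=
  ∃ f g : ℝ → ℝ, (f : Germ (atTop : Filter ℝ) ℝ) = a ∧ (g : Germ (atTop : Filter ℝ) ℝ) = b ∧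
    ∀ᶠ x in atTop, HasDerivAt f (g x) x

namespace GermHasDeriv

theorem of_coe {f g : ℝ → ℝ} (h : GermHasDeriv (f : Germ (atTop : Filter ℝ) ℝ) g) :
    ∀ᶠ x in atTop, HasDerivAt f (g x) x := by
  obtain ⟨f', g', hf, hg, h⟩ := h
  rw [Germ.coe_eq] at hf hg
  obtain ⟨X, hX⟩ := eventually_atTop.1 (hf.and (hg.and h))
  -- Strict inequality makes the representatives agree on a whole neighbourhood of `x`, which the
  -- derivative needs.
  filter_upwards [eventually_gt_atTop X] with x hx
  have h1 := (hX x hx.le).2.2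
  rw [(hX x hx.le).2.1] at h1
  refine h1.congr_of_eventuallyEq ?_
  filter_upwards [eventually_gt_nhds hx] with y hy using (hX y hy.le).1.symm

theorem coe {f g : ℝ → ℝ} (h : ∀ᶠ x in atTop, HasDerivAt f (g x) x) :
    GermHasDeriv (f : Germ (atTop : Filter ℝ) ℝ) g := ⟨f, g, rfl, rfl, h⟩

theorem const (c : ℝ) : GermHasDeriv ((fun _ => c : ℝ → ℝ) : Germ (atTop : Filter ℝ) ℝ) 0 :=
  coe (g := 0) (.of_forall fun x => hasDerivAt_const x c)

variable {a b a' b' : Germ (atTop : Filter ℝ) ℝ}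

theorem add (ha : GermHasDeriv a a') (hb : GermHasDeriv b b') :
    GermHasDeriv (a + b) (a' + b') := by
  obtain ⟨f, f', rfl, rfl, hf⟩ := ha
  obtain ⟨g, g', rfl, rfl, hg⟩ := hb
  refine ⟨f + g, f' + g', rfl, rfl, ?_⟩
  filter_upwards [hf, hg] with x h1 h2 using h1.add h2

theorem mul (ha : GermHasDeriv a a') (hb : GermHasDeriv b b') :
    GermHasDeriv (a * b) (a' * b + a * b') := by
  obtain ⟨f, f', rfl, rfl, hf⟩ := ha
  obtain ⟨g, g', rfl, rfl, hg⟩ := hb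
  refine ⟨f * g, f' * g + f * g', rfl, rfl, ?_⟩
  filter_upwards [hf, hg] with x h1 h2 using h1.mul h2

theorem pow (ha : GermHasDeriv a a') (n : ℕ) : GermHasDeriv (a ^ n) (n * a ^ (n - 1) * a') := by
  induction n with
  | zero => simpa using! const 1
  | succ n ih =>
    rw [pow_succ]
    convert! ih.mul ha using 1
    rcases n with _ | n
    · simp
    · simp [pow_succ]; ring

end GermHasDeriv

theorem germ_isUnit_iff {f : ℝ → ℝ} :
    IsUnit (f : Germ (atTop : Filter ℝ) ℝ) ↔ ∀ᶠ x in atTop, f x ≠ 0 := by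
  constructor
  · intro h
    obtain ⟨b, hb⟩ := h.exists_right_inv
    induction b using Germ.inductionOn with | _ g
    rw [← Germ.coe_mul, ← Germ.coe_one, Germ.coe_eq] at hb
    filter_upwards [hb] with x hx h0
    simp [h0] at hx
  · intro h
    refine IsUnit.of_mul_eq_one (f⁻¹ : ℝ → ℝ) ?_
    rw [← Germ.coe_mul, ← Germ.coe_one, Germ.coe_eq]
    filter_upwards [h] with x hx
    simp [hx]

theorem germ_eq_zero_iff {f : ℝ → ℝ} :
    (f : Germ (atTop : Filter ℝ) ℝ) = 0 ↔ ∀ᶠ x in atTop, f x = 0 := by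
  rw [← Germ.coe_zero, Germ.coe_eq]; rfl

theorem GermHasDeriv.div {a b a' b' z : Germ (atTop : Filter ℝ) ℝ}
    (ha : GermHasDeriv a a') (hb : GermHasDeriv b b') (hu : IsUnit b) (hz : z * b = a) :
    ∃ z', GermHasDeriv z z' ∧ z' * (b * b) = a' * b - a * b' := by
  obtain ⟨f, f', rfl, rfl, hf⟩ := ha
  obtain ⟨g, g', rfl, rfl, hg⟩ := hb
  have hg0 := germ_isUnit_iff.1 hu
  have hz' : z = ((f / g : ℝ → ℝ) : Germ (atTop : Filter ℝ) ℝ) := by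
    refine hu.mul_right_cancel (hz.trans ?_)
    rw [← Germ.coe_mul, Germ.coe_eq]
    filter_upwards [hg0] with x hx
    simp [hx]
  refine ⟨((fun x => (f' x * g x - f x * g' x) / g x ^ 2 : ℝ → ℝ)), ?_, ?_⟩
  · rw [hz']
    refine GermHasDeriv.coe ?_
    filter_upwards [hf, hg, hg0] with x h1 h2 h3 using h1.div h2 h3
  · rw [← Germ.coe_mul, ← Germ.coe_mul, ← Germ.coe_mul, ← Germ.coe_mul, ← Germ.coe_sub,
      Germ.coe_eq]
    filter_upwards [hg0] with x hx
    simp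
    field_simp

/-- A germ whose derivative is zero or ultimately nonvanishing is itself zero or ultimately
nonvanishing. -/
theorem GermHasDeriv.eq_zero_or_isUnit {a b : Germ (atTop : Filter ℝ) ℝ}
    (h : GermHasDeriv a b) (hb : b = 0 ∨ IsUnit b) : a = 0 ∨ IsUnit a := by
  obtain ⟨f, g, rfl, rfl, h⟩ := h
  rw [germ_eq_zero_iff, germ_isUnit_iff] at hb ⊢
  rcases hb with hb | hb
  · obtain ⟨X, hX⟩ := eventually_atTop.1 (h.and hb)
    have hc : ∀ x ≥ X, f x = f X := by
      intro x hx
      refine constant_of_has_deriv_right_zero (a := X) (b := x)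
        (fun y hy => (hX y hy.1).1.continuousAt.continuousWithinAt) (fun y hy => ?_) x ⟨hx, le_rfl⟩
      have h1 := (hX y hy.1).1
      rw [(hX y hy.1).2] at h1
      exact h1.hasDerivWithinAt
    by_cases h0 : f X = 0
    · exact .inl (eventually_atTop.2 ⟨X, fun x hx => (hc x hx).trans h0⟩)
    · exact .inr (eventually_atTop.2 ⟨X, fun x hx => by rwa [hc x hx]⟩)
  · right
    obtain ⟨X, hX⟩ := eventually_atTop.1 (h.and hb)
    by_cases h0 : ∀ x ≥ X, f x ≠ 0
    · exact eventually_atTop.2 ⟨X, h0⟩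
    · push Not at h0
      obtain ⟨x, hx, hfx⟩ := h0
      filter_upwards [eventually_gt_atTop x] with y hy hfy
      -- By Rolle, a second zero of `f` beyond `X` would produce a zero of `g` there.
      obtain ⟨z, hz, hz0⟩ := exists_hasDerivAt_eq_zero (f := f) (f' := g) hy
        (fun w hw => (hX w (hx.trans hw.1)).1.continuousAt.continuousWithinAt)
        (hfx.trans hfy.symm) (fun w hw => (hX w (hx.trans hw.1.le)).1)
      exact (hX z (hx.trans hz.1.le)).2 hz0

/-! ### Hardy fields -/

/-- Hardy fields: differential fields of germs at `+∞`, containing the real constants. -/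
structure IsHardyField (K : Subring (Germ (atTop : Filter ℝ) ℝ)) : Prop where
  const_mem : ∀ c : ℝ, ((fun _ => c : ℝ → ℝ) : Germ (atTop : Filter ℝ) ℝ) ∈ K
  exists_inv : ∀ a ∈ K, a ≠ 0 → ∃ b ∈ K, a * b = 1
  exists_deriv : ∀ a ∈ K, ∃ b ∈ K, GermHasDeriv a b

theorem IsHardyField.eq_zero_or_isUnit {K : Subring (Germ (atTop : Filter ℝ) ℝ)}
    (hK : IsHardyField K) {a : Germ (atTop : Filter ℝ) ℝ} (ha : a ∈ K) : a = 0 ∨ IsUnit a := by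
  by_cases h : a = 0
  · exact .inl h
  · obtain ⟨b, -, hb⟩ := hK.exists_inv a ha h
    exact .inr (IsUnit.of_mul_eq_one b hb)

/-- The constants form a Hardy field. -/
theorem exists_isHardyField : ∃ K : Subring (Germ (atTop : Filter ℝ) ℝ), IsHardyField K := by
  let φ : ℝ →+* Germ (atTop : Filter ℝ) ℝ :=
    (Germ.coeRingHom (atTop : Filter ℝ)).comp (Pi.constRingHom ℝ ℝ)
  refine ⟨φ.range, fun c => ⟨c, rfl⟩, ?_, ?_⟩
  · rintro _ ⟨c, rfl⟩ hc
    have hc0 : c ≠ 0 := fun h => hc (by simp [h])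
    exact ⟨φ c⁻¹, ⟨_, rfl⟩, by rw [← map_mul, mul_inv_cancel₀ hc0, map_one]⟩
  · rintro _ ⟨c, rfl⟩
    exact ⟨0, zero_mem _, GermHasDeriv.const c⟩

/-! ### Extending a Hardy field by one element -/

section Extension

open Polynomial

variable {K : Subring (Germ (atTop : Filter ℝ) ℝ)} {y : Germ (atTop : Filter ℝ) ℝ}

/-- If `y' = α y + β`, then the derivative of a polynomial in `y` is a polynomial in `y`
of no larger degree. -/
theorem IsHardyField.exists_deriv_aeval (hK : IsHardyField K) {α β : K}
    (hy : GermHasDeriv y (α * y + β)) {n : ℕ} {P : K[X]} (hP : P.natDegree ≤ n) :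
    ∃ Q : K[X], Q.natDegree ≤ n ∧ GermHasDeriv (aeval y P) (aeval y Q) := by
  refine Polynomial.induction_with_natDegree_le
    (fun P => ∃ Q : K[X], Q.natDegree ≤ n ∧ GermHasDeriv (aeval y P) (aeval y Q)) n ?_ ?_ ?_ P hP
  · exact ⟨0, by simp, by simpa using! GermHasDeriv.const 0⟩
  · intro i a _ hi
    obtain ⟨a', ha', had⟩ := hK.exists_deriv a a.2
    refine ⟨C (⟨a', ha'⟩ : K) * X ^ i + C a * ((i : K[X]) * X ^ (i - 1) * (C α * X + C β)), ?_, ?_⟩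
    · refine (natDegree_add_le _ _).trans (max_le ?_ ?_)
      · exact (natDegree_C_mul_X_pow_le _ _).trans hi
      · rcases i with _ | i
        · simp
        · refine le_trans ?_ hi
          rw [Nat.add_sub_cancel]
          compute_degree
    · have h := had.mul (hy.pow i)
      simpa [mul_assoc] using! h
  · rintro P Q - - ⟨P', hP', hPd⟩ ⟨Q', hQ', hQd⟩
    refine ⟨P' + Q', (natDegree_add_le _ _).trans (max_le hP' hQ'), ?_⟩
    simpa using hPd.add hQd

/-- If all polynomials in `y` are zero or invertible, then `K(y)` is a Hardy field. -/
theorem IsHardyField.exists_extension (hK : IsHardyField K) {α β : K}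
    (hy : GermHasDeriv y (α * y + β))
    (h0 : ∀ P : K[X], aeval y P = 0 ∨ IsUnit (aeval y P)) :
    ∃ L : Subring (Germ (atTop : Filter ℝ) ℝ), IsHardyField L ∧ K ≤ L ∧ y ∈ L := by
  have hmem : ∀ z : Germ (atTop : Filter ℝ) ℝ, ∀ P : K[X], z = aeval y P →
      ∃ P Q : K[X], IsUnit (aeval y Q) ∧ z * aeval y Q = aeval y P := by
    intro z P hz
    exact ⟨P, 1, by simp, by simp [hz]⟩
  -- Fractions are encoded by `z * Q(y) = P(y)` with `Q(y)` a unit, because the ring of germs has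
  -- zero divisors and no field of fractions inside it is given in advance.
  let L : Subring (Germ (atTop : Filter ℝ) ℝ) :=
    { carrier := {z | ∃ P Q : K[X], IsUnit (aeval y Q) ∧ z * aeval y Q = aeval y P}
      zero_mem' := hmem 0 0 (by simp)
      one_mem' := hmem 1 1 (by simp)
      add_mem' := by
        rintro z w ⟨P, Q, hQ, hz⟩ ⟨R, S, hS, hw⟩
        refine ⟨P * S + R * Q, Q * S, by simpa using ⟨hQ, hS⟩, ?_⟩
        simp only [map_mul, map_add, ← hz, ← hw]; ring
      mul_mem' := by
        rintro z w ⟨P, Q, hQ, hz⟩ ⟨R, S, hS, hw⟩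
        refine ⟨P * R, Q * S, by simpa using ⟨hQ, hS⟩, ?_⟩
        simp only [map_mul, ← hz, ← hw]; ring
      neg_mem' := by
        rintro z ⟨P, Q, hQ, hz⟩
        exact ⟨-P, Q, hQ, by simp [← hz]⟩ }
  have hKL : K ≤ L := fun a ha => hmem a (C ⟨a, ha⟩) (by simp; rfl)
  refine ⟨L, ⟨fun c => hKL (hK.const_mem c), ?_, ?_⟩, hKL, hmem y X (by simp)⟩
  · rintro z ⟨P, Q, hQ, hz⟩ hz0
    have hP : IsUnit (aeval y P) := by
      refine (h0 P).resolve_left fun h => hz0 ?_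
      rw [h] at hz
      exact (hQ.mul_left_eq_zero).1 hz
    obtain ⟨w, hw⟩ := hP.exists_right_inv
    refine ⟨w * aeval y Q, ⟨Q, P, hP, ?_⟩, by rw [← hw, ← hz]; ring⟩
    calc w * aeval y Q * aeval y P = aeval y Q * (aeval y P * w) := by ring
      _ = _ := by rw [hw, mul_one]
  · rintro z ⟨P, Q, hQ, hz⟩
    obtain ⟨P', -, hP'⟩ := hK.exists_deriv_aeval hy (le_refl P.natDegree)
    obtain ⟨Q', -, hQ'⟩ := hK.exists_deriv_aeval hy (le_refl Q.natDegree)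
    obtain ⟨z', hz', he⟩ := hP'.div hQ' hQ hz
    exact ⟨z', ⟨P' * Q - P * Q', Q * Q, by simpa using hQ, by simpa using he⟩, hz'⟩

/-- Nonzero elements of `K` are units, so one coefficient of `P` may be normalized to 1. -/
theorem IsHardyField.aeval_eq_zero_or_isUnit_of_smul (hK : IsHardyField K) {a : K} (ha : a ≠ 0)
    {P : K[X]} (h : ∀ b : K, b * a = 1 →
      aeval y (C b * P) = 0 ∨ IsUnit (aeval y (C b * P))) :
    aeval y P = 0 ∨ IsUnit (aeval y P) := by
  obtain ⟨b, hb, hab⟩ := hK.exists_inv a a.2 (by simpa using ha)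
  have hb' : (⟨b, hb⟩ : K) * a = 1 := by ext; simpa [mul_comm] using hab
  have hu : IsUnit b := IsUnit.of_mul_eq_one _ (by rwa [mul_comm] at hab)
  have := h ⟨b, hb⟩ hb'
  rw [map_mul, aeval_C] at this
  change b * _ = 0 ∨ IsUnit (b * _) at this
  rcases this with h | h
  · exact .inl ((hu.mul_right_eq_zero).1 h)
  · exact .inr (isUnit_of_mul_isUnit_right h)

/-- Adjoining an exponential integral. -/
theorem IsHardyField.exists_extension_exp (hK : IsHardyField K) {α : K}
    (hy : GermHasDeriv y (α * y)) (hu : IsUnit y) :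
    ∃ L : Subring (Germ (atTop : Filter ℝ) ℝ), IsHardyField L ∧ K ≤ L ∧ y ∈ L := by
  have hy' : GermHasDeriv y (α * y + (0 : K)) := by simpa using hy
  refine hK.exists_extension hy' fun P => ?_
  obtain ⟨n, hn⟩ : ∃ n, P.natDegree ≤ n := ⟨_, le_rfl⟩
  induction n generalizing P with
  | zero =>
    rw [Polynomial.eq_C_of_natDegree_le_zero hn, aeval_C]
    exact hK.eq_zero_or_isUnit (P.coeff 0).2
  | succ n ih =>
    have hdiv : ∀ P : K[X], P.natDegree ≤ n + 1 → P.divX.natDegree ≤ n := fun P hP => by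
      rw [natDegree_divX_eq_natDegree_tsub_one]; omega
    by_cases h0 : P.coeff 0 = 0
    · have hP : aeval y P = aeval y P.divX * y := by
        conv_lhs => rw [← divX_mul_X_add P, h0]
        simp
      rw [hP]
      rcases ih _ (hdiv P hn) with h | h
      · exact .inl (by rw [h, zero_mul])
      · exact .inr (h.mul hu)
    -- A constant coefficient 1 disappears on differentiation, so the derivative of `Q(y)` is `y`
    -- times a polynomial in `y` of degree at most `n`. Induction applies to that factor, and Rolle
    -- passes from the derivative back to `Q(y)`.
    · refine hK.aeval_eq_zero_or_isUnit_of_smul h0 fun b hb => ?_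
      set Q := C b * P with hQ
      have hQ0 : Q.coeff 0 = 1 := by rw [hQ, coeff_C_mul, hb]
      have hQn : Q.natDegree ≤ n + 1 := (natDegree_C_mul_le _ _).trans hn
      obtain ⟨R, hR, hd⟩ := hK.exists_deriv_aeval hy' (hdiv Q hQn)
      have hQe : aeval y Q = aeval y Q.divX * y + 1 := by
        conv_lhs => rw [← divX_mul_X_add Q, hQ0]
        simp
      have h1 := (hd.mul hy).add (GermHasDeriv.const 1)
      refine GermHasDeriv.eq_zero_or_isUnit (b := aeval y (R + C α * Q.divX) * y) ?_ ?_
      · rw [hQe]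
        convert! h1 using 1
        simp only [map_add, map_mul, aeval_C, add_zero]
        change (_ + (α : Germ (atTop : Filter ℝ) ℝ) * _) * _ = _
        ring
      · rcases ih (R + C α * Q.divX) ((natDegree_add_le _ _).trans
          (max_le hR ((natDegree_C_mul_le _ _).trans (hdiv Q hQn)))) with h | h
        · exact .inl (by rw [h, zero_mul])
        · exact .inr (h.mul hu)

/-- Adjoining an antiderivative. -/
theorem IsHardyField.exists_extension_antideriv (hK : IsHardyField K) {β : K}
    (hy : GermHasDeriv y β) :
    ∃ L : Subring (Germ (atTop : Filter ℝ) ℝ), IsHardyField L ∧ K ≤ L ∧ y ∈ L := by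
  have hy' : GermHasDeriv y ((0 : K) * y + β) := by simpa using hy
  refine hK.exists_extension hy' fun P => ?_
  obtain ⟨n, hn⟩ : ∃ n, P.natDegree ≤ n := ⟨_, le_rfl⟩
  induction n generalizing P with
  | zero =>
    rw [Polynomial.eq_C_of_natDegree_le_zero hn, aeval_C]
    exact hK.eq_zero_or_isUnit (P.coeff 0).2
  | succ n ih =>
    have herase : ∀ P : K[X], P.natDegree ≤ n + 1 →
        (P - C (P.coeff (n + 1)) * X ^ (n + 1)).natDegree ≤ n := fun P hP => by
      rw [natDegree_le_iff_coeff_eq_zero]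
      intro N hN
      rw [coeff_sub, coeff_C_mul, coeff_X_pow]
      rcases eq_or_ne N (n + 1) with rfl | h
      · simp
      · rw [coeff_eq_zero_of_natDegree_lt (by omega), if_neg h]; simp
    by_cases h0 : P.coeff (n + 1) = 0
    · refine ih P ?_
      simpa [h0] using herase P hn
    -- With leading coefficient 1, the top term differentiates to `(n + 1) β y ^ n`, so the
    -- derivative of `Q(y)` has degree at most `n` in `y`.
    · refine hK.aeval_eq_zero_or_isUnit_of_smul h0 fun b hb => ?_
      set Q := C b * P with hQ
      have hQ0 : Q.coeff (n + 1) = 1 := by rw [hQ, coeff_C_mul, hb]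
      have hQn : Q.natDegree ≤ n + 1 := (natDegree_C_mul_le _ _).trans hn
      have hQe := herase Q hQn
      rw [hQ0] at hQe
      obtain ⟨R, hR, hd⟩ := hK.exists_deriv_aeval hy' hQe
      have h1 := hd.add (hy.pow (n + 1))
      refine GermHasDeriv.eq_zero_or_isUnit
        (b := aeval y (R + C ((n + 1 : ℕ) * β) * X ^ n)) ?_ (ih _ ?_)
      · convert! h1 using 1
        · simp
        · simp only [map_add, map_mul, aeval_C, map_pow, aeval_X]
          rw [Nat.add_sub_cancel]
          simp
          change _ * (β : Germ (atTop : Filter ℝ) ℝ) * _ = _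
          ring
      · exact (natDegree_add_le _ _).trans (max_le hR (natDegree_C_mul_X_pow_le _ _))

end Extension

/-! ### Logarithmico-exponential germs lie in Hardy fields -/

/-- Every Hardy field has a Hardy extension field that contains a given
logarithmico-exponential germ. -/
theorem IsLogExp.exists_isHardyField {f : ℝ → ℝ} (hf : IsLogExp f)
    {K : Subring (Germ (atTop : Filter ℝ) ℝ)} (hK : IsHardyField K) :
    ∃ L : Subring (Germ (atTop : Filter ℝ) ℝ), IsHardyField L ∧ K ≤ L ∧
      (f : Germ (atTop : Filter ℝ) ℝ) ∈ L := by
  -- `K` must vary: the field obtained for one operand is the base field for the other.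
  induction hf generalizing K with
  | const c => exact ⟨K, hK, le_rfl, hK.const_mem c⟩
  | id =>
    refine hK.exists_extension_antideriv (β := 1) ?_
    exact GermHasDeriv.coe (g := 1) (.of_forall fun x => hasDerivAt_id x)
  | add _ _ ihf ihg =>
    obtain ⟨L, hL, hKL, hf⟩ := ihf hK
    obtain ⟨M, hM, hLM, hg⟩ := ihg hL
    exact ⟨M, hM, hKL.trans hLM, add_mem (hLM hf) hg⟩
  | sub _ _ ihf ihg =>
    obtain ⟨L, hL, hKL, hf⟩ := ihf hK
    obtain ⟨M, hM, hLM, hg⟩ := ihg hL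
    exact ⟨M, hM, hKL.trans hLM, sub_mem (hLM hf) hg⟩
  | mul _ _ ihf ihg =>
    obtain ⟨L, hL, hKL, hf⟩ := ihf hK
    obtain ⟨M, hM, hLM, hg⟩ := ihg hL
    exact ⟨M, hM, hKL.trans hLM, mul_mem (hLM hf) hg⟩
  | @div f g _ _ h0 ihf ihg =>
    obtain ⟨L, hL, hKL, hf⟩ := ihf hK
    obtain ⟨M, hM, hLM, hg⟩ := ihg hL
    refine ⟨M, hM, hKL.trans hLM, ?_⟩
    have hu := germ_isUnit_iff.2 h0
    obtain ⟨b, hb, hgb⟩ := hM.exists_inv _ hg hu.ne_zero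
    have : ((fun x => f x / g x : ℝ → ℝ) : Germ (atTop : Filter ℝ) ℝ) = f * b := by
      refine hu.mul_right_cancel ?_
      rw [mul_assoc, mul_comm b, hgb, mul_one, ← Germ.coe_mul, Germ.coe_eq]
      filter_upwards [h0] with x hx
      simp [hx]
    rw [this]
    exact mul_mem (hLM hf) hb
  | @exp f _ ihf =>
    obtain ⟨L, hL, hKL, hf⟩ := ihf hK
    obtain ⟨b, hb, hfb⟩ := hL.exists_deriv _ hf
    induction b using Germ.inductionOn with | _ g
    obtain ⟨M, hM, hLM, h⟩ := hL.exists_extension_exp (α := ⟨g, hb⟩)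
      (y := ((fun x => Real.exp (f x) : ℝ → ℝ) : Germ (atTop : Filter ℝ) ℝ)) (by
        rw [← Germ.coe_mul]
        refine GermHasDeriv.coe ?_
        filter_upwards [hfb.of_coe] with x hx
        simpa [mul_comm] using hx.exp)
      (germ_isUnit_iff.2 (.of_forall fun x => (Real.exp_pos _).ne'))
    exact ⟨M, hM, hKL.trans hLM, h⟩
  | @log f _ h0 ihf =>
    obtain ⟨L, hL, hKL, hf⟩ := ihf hK
    obtain ⟨b, hb, hfb⟩ := hL.exists_deriv _ hf
    have hu : IsUnit (f : Germ (atTop : Filter ℝ) ℝ) :=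
      germ_isUnit_iff.2 (h0.mono fun x hx => hx.ne')
    obtain ⟨i, hi, hfi⟩ := hL.exists_inv _ hf hu.ne_zero
    induction b using Germ.inductionOn with | _ g
    have hgi : ((fun x => g x / f x : ℝ → ℝ) : Germ (atTop : Filter ℝ) ℝ) = g * i := by
      refine hu.mul_right_cancel ?_
      rw [mul_assoc, mul_comm i, hfi, mul_one, ← Germ.coe_mul, Germ.coe_eq]
      filter_upwards [h0] with x hx
      simp [hx.ne']
    obtain ⟨M, hM, hLM, h⟩ := hL.exists_extension_antideriv
      (β := ⟨_, hgi ▸ mul_mem hb hi⟩)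
      (y := ((fun x => Real.log (f x) : ℝ → ℝ) : Germ (atTop : Filter ℝ) ℝ)) (by
        refine GermHasDeriv.coe ?_
        filter_upwards [hfb.of_coe, h0] with x hx hx0 using hx.log hx0.ne')
    exact ⟨M, hM, hKL.trans hLM, h⟩

/-- Finitely many logarithmico-exponential germs lie in a common Hardy field. -/
theorem exists_isHardyField_of_finset {ι : Type*} (s : Finset ι) {f : ι → ℝ → ℝ}
    (hf : ∀ i, IsLogExp (f i)) :
    ∃ K : Subring (Germ (atTop : Filter ℝ) ℝ), IsHardyField K ∧
      ∀ i ∈ s, (f i : Germ (atTop : Filter ℝ) ℝ) ∈ K := by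
  classical
  induction s using Finset.induction_on with
  | empty =>
    obtain ⟨K, hK⟩ := _root_.exists_isHardyField
    exact ⟨K, hK, by simp⟩
  | insert i s _ ih =>
    obtain ⟨K, hK, hs⟩ := ih
    obtain ⟨L, hL, hKL, hi⟩ := (hf i).exists_isHardyField hK
    refine ⟨L, hL, fun j hj => ?_⟩
    rcases Finset.mem_insert.1 hj with rfl | hj
    · exact hi
    · exact hKL (hs j hj)

/-! ### Signs, comparison and limits in a Hardy field -/

namespace IsHardyField

variable {K : Subring (Germ (atTop : Filter ℝ) ℝ)}

theorem exists_hasDerivAt (hK : IsHardyField K) {f : ℝ → ℝ}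
    (hf : (f : Germ (atTop : Filter ℝ) ℝ) ∈ K) :
    ∃ g : ℝ → ℝ, (g : Germ (atTop : Filter ℝ) ℝ) ∈ K ∧ ∀ᶠ x in atTop, HasDerivAt f (g x) x := by
  obtain ⟨b, hb, h⟩ := hK.exists_deriv _ hf
  induction b using Germ.inductionOn with | _ g
  exact ⟨g, hb, h.of_coe⟩

theorem eventually_continuousAt (hK : IsHardyField K) {f : ℝ → ℝ}
    (hf : (f : Germ (atTop : Filter ℝ) ℝ) ∈ K) : ∀ᶠ x in atTop, ContinuousAt f x := by
  obtain ⟨g, -, h⟩ := hK.exists_hasDerivAt hf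
  exact h.mono fun x hx => hx.continuousAt

theorem eventually_nonneg_or_nonpos (hK : IsHardyField K) {f : ℝ → ℝ}
    (hf : (f : Germ (atTop : Filter ℝ) ℝ) ∈ K) :
    (∀ᶠ x in atTop, 0 ≤ f x) ∨ ∀ᶠ x in atTop, f x ≤ 0 := by
  rcases hK.eq_zero_or_isUnit hf with h | h
  · exact .inl ((germ_eq_zero_iff.1 h).mono fun x hx => hx.ge)
  · obtain ⟨X, hX⟩ := eventually_atTop.1
      ((germ_isUnit_iff.1 h).and (hK.eventually_continuousAt hf))
    by_contra! hc
    obtain ⟨h1, h2⟩ := hc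
    simp only [frequently_atTop] at h1 h2
    obtain ⟨a, ha, hfa⟩ := h1 X
    obtain ⟨b, hb, hfb⟩ := h2 X
    have hcont : ContinuousOn f (Set.Ici X) :=
      fun x hx => (hX x hx).2.continuousWithinAt
    obtain ⟨c, hc, hc0⟩ := isPreconnected_Ici.intermediate_value ha hb hcont ⟨hfa.le, hfb.le⟩
    exact (hX c hc).1 hc0

/-- The germ `g² - f²` belongs to `K` and so has an ultimately constant sign. -/
theorem eventually_abs_le_or_abs_le (hK : IsHardyField K) {f g : ℝ → ℝ}
    (hf : (f : Germ (atTop : Filter ℝ) ℝ) ∈ K) (hg : (g : Germ (atTop : Filter ℝ) ℝ) ∈ K) :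
    (∀ᶠ x in atTop, |f x| ≤ |g x|) ∨ ∀ᶠ x in atTop, |g x| ≤ |f x| := by
  have h : ((g * g - f * f : ℝ → ℝ) : Germ (atTop : Filter ℝ) ℝ) ∈ K :=
    sub_mem (mul_mem hg hg) (mul_mem hf hf)
  refine (hK.eventually_nonneg_or_nonpos h).imp (fun h => h.mono fun x hx => ?_)
    (fun h => h.mono fun x hx => ?_) <;> simp at hx <;>
    exact sq_le_sq.1 (by nlinarith)

theorem exists_dominant (hK : IsHardyField K) {ι : Type*} {s : Finset ι} (hs : s.Nonempty)
    {f : ι → ℝ → ℝ} (hf : ∀ i ∈ s, (f i : Germ (atTop : Filter ℝ) ℝ) ∈ K) :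
    ∃ i ∈ s, ∀ j ∈ s, ∀ᶠ x in atTop, |f j x| ≤ |f i x| := by
  induction hs using Finset.Nonempty.cons_induction with
  | singleton i => exact ⟨i, by simp, by simp⟩
  | cons i s hi hs ih =>
    obtain ⟨k, hk, hkm⟩ := ih fun j hj => hf j (Finset.mem_cons_of_mem hj)
    rcases hK.eventually_abs_le_or_abs_le (hf i (Finset.mem_cons_self i s))
      (hf k (Finset.mem_cons_of_mem hk)) with h | h
    · refine ⟨k, Finset.mem_cons_of_mem hk, fun j hj => ?_⟩
      rcases Finset.mem_cons.1 hj with rfl | hj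
      exacts [h, hkm j hj]
    · refine ⟨i, Finset.mem_cons_self i s, fun j hj => ?_⟩
      rcases Finset.mem_cons.1 hj with rfl | hj
      · exact .of_forall fun x => le_rfl
      · filter_upwards [h, hkm j hj] with x h1 h2 using h2.trans h1

theorem exists_tendsto_of_nonneg_deriv {f g : ℝ → ℝ}
    (hfg : ∀ᶠ x in atTop, HasDerivAt f (g x) x) (hg : ∀ᶠ x in atTop, 0 ≤ g x)
    {C : ℝ} (hC : ∀ᶠ x in atTop, |f x| ≤ C) : ∃ l, Tendsto f atTop (nhds l) := by
  obtain ⟨X, hX⟩ := eventually_atTop.1 (hfg.and (hg.and hC))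
  have hm : MonotoneOn f (Set.Ici X) := by
    refine monotoneOn_of_hasDerivWithinAt_nonneg (f' := g) (convex_Ici X)
      (fun x hx => (hX x hx).1.continuousAt.continuousWithinAt) (fun x hx => ?_) (fun x hx => ?_)
    · exact (hX x (interior_subset hx)).1.hasDerivWithinAt
    · exact (hX x (interior_subset hx)).2.1
  have hm' : Monotone fun x => f (max x X) := fun x y hxy =>
    hm (Set.mem_Ici.2 (le_max_right _ _)) (Set.mem_Ici.2 (le_max_right _ _)) (max_le_max_right _ hxy)
  have he : (fun x => f (max x X)) =ᶠ[atTop] f := by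
    filter_upwards [eventually_ge_atTop X] with x hx
    rw [max_eq_left hx]
  have hb : BddAbove (Set.range fun x => f (max x X)) :=
    ⟨C, by rintro _ ⟨x, rfl⟩; exact (le_abs_self _).trans (hX _ (le_max_right _ _)).2.2⟩
  exact ⟨_, (tendsto_atTop_ciSup hm' hb).congr' he⟩

/-- The derivative again lies in `K`, hence has constant sign; `f` is ultimately monotone, and it is
bounded. -/
theorem exists_tendsto (hK : IsHardyField K) {f : ℝ → ℝ}
    (hf : (f : Germ (atTop : Filter ℝ) ℝ) ∈ K) {C : ℝ} (hC : ∀ᶠ x in atTop, |f x| ≤ C) :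
    ∃ l, Tendsto f atTop (nhds l) := by
  obtain ⟨g, hg, hfg⟩ := hK.exists_hasDerivAt hf
  rcases hK.eventually_nonneg_or_nonpos hg with h | h
  · exact exists_tendsto_of_nonneg_deriv hfg h hC
  · obtain ⟨l, hl⟩ := exists_tendsto_of_nonneg_deriv (f := fun x => - f x) (g := fun x => -g x)
      (hfg.mono fun x hx => hx.neg) (h.mono fun x hx => neg_nonneg.2 hx) (C := C) (by simpa using hC)
    exact ⟨-l, by simpa using hl.neg⟩

end IsHardyField

/-! ### Exponentials over logarithmico-exponential germs -/

/-- A trigonometric polynomial that tends to zero at `+∞` vanishes. -/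
theorem eq_zero_of_tendsto_sum_exp (W : Finset ℝ) (z : ℝ → ℂ)
    (h : Tendsto (fun x : ℝ => ∑ ω ∈ W, Complex.exp (ω * x * Complex.I) * z ω) atTop (nhds 0)) :
    ∀ ω ∈ W, z ω = 0 := by
  induction W using Finset.induction_on generalizing z with
  | empty => simp
  | insert ν W hν ih =>
    have hW : ∀ ω ∈ W, z ω = 0 := by
      intro ω hω
      have hne : ω - ν ≠ 0 := sub_ne_zero.2 fun h => hν (h ▸ hω)
      -- This shift gives `exp (iωτ) = -exp (iντ)`. Subtracting `exp (iντ)` times the sum from its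
      -- shift by `τ` kills the frequency `ν` and multiplies the coefficient at `ω` by `-2 exp (iντ)
      -- ≠ 0`.
      set τ : ℝ := Real.pi / (ω - ν) with hτ
      have h1 := (h.comp (tendsto_atTop_add_const_right atTop τ tendsto_id)).sub
        (h.const_mul (Complex.exp (ν * τ * Complex.I)))
      have h2 := ih (fun ξ => (Complex.exp (ξ * τ * Complex.I) - Complex.exp (ν * τ * Complex.I))
        * z ξ) (by
          convert! h1 using 2 with x
          · simp only [Function.comp, id, Finset.sum_insert hν, mul_add, Finset.mul_sum]
            rw [add_sub_add_comm, ← Finset.sum_sub_distrib]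
            rw [← mul_assoc (Complex.exp (ν * τ * Complex.I)), ← Complex.exp_add]
            rw [show (ν : ℂ) * ((x + τ : ℝ) : ℂ) * Complex.I =
              ν * τ * Complex.I + ν * x * Complex.I by push_cast; ring, sub_self, zero_add]
            refine Finset.sum_congr rfl fun ξ _ => ?_
            rw [show (ξ : ℂ) * ((x + τ : ℝ) : ℂ) * Complex.I =
              ξ * τ * Complex.I + ξ * x * Complex.I by push_cast; ring, Complex.exp_add]
            ring
          · simp) ω hω
      refine (mul_eq_zero.1 h2).resolve_left fun h3 => ?_
      have h4 : (ω : ℂ) * τ * Complex.I = Real.pi * Complex.I + ν * τ * Complex.I := by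
        have : ω * τ = Real.pi + ν * τ := by
          rw [hτ]; field_simp; ring
        rw [← Complex.ofReal_mul, this]; push_cast; ring
      rw [h4, Complex.exp_add, Complex.exp_pi_mul_I] at h3
      have h5 := Complex.exp_ne_zero (ν * τ * Complex.I)
      apply h5
      linear_combination (-1 / 2 : ℂ) * h3
    intro ω hω
    rcases Finset.mem_insert.1 hω with rfl | hω
    · have h1 : Tendsto (fun x : ℝ => Complex.exp (ω * x * Complex.I) * z ω) atTop (nhds 0) := by
        refine h.congr fun x => ?_
        rw [Finset.sum_insert hν, Finset.sum_eq_zero, add_zero]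
        intro ξ hξ
        rw [hW ξ hξ, mul_zero]
      have h2 := h1.norm
      simp only [norm_mul, ← Complex.ofReal_mul, Complex.norm_exp_ofReal_mul_I, one_mul,
        norm_zero] at h2
      simpa using tendsto_nhds_unique tendsto_const_nhds h2
    · exact hW ω hω

/-- Exponentials `x ↦ exp (i ω x)` are linearly independent over the logarithmico-exponential
germs. -/
theorem eventually_eq_zero_of_sum_exp (W : Finset ℝ) {u v : ℝ → ℝ → ℝ}
    (hu : ∀ ω, IsLogExp (u ω)) (hv : ∀ ω, IsLogExp (v ω))
    (h : ∀ᶠ x : ℝ in atTop,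
      ∑ ω ∈ W, Complex.exp (ω * x * Complex.I) * (u ω x + v ω x * Complex.I) = 0) :
    ∀ ω ∈ W, ∀ᶠ x in atTop, u ω x = 0 ∧ v ω x = 0 := by
  rcases W.eq_empty_or_nonempty with rfl | hW
  · simp
  -- Real and imaginary parts form one family, so that a single germ dominates them all.
  let f : ℝ × Bool → ℝ → ℝ := fun p => if p.2 then u p.1 else v p.1
  have hf : ∀ p, IsLogExp (f p) := by
    rintro ⟨ω, _ | _⟩
    exacts [hv ω, hu ω]
  obtain ⟨K, hK, hfK⟩ := exists_isHardyField_of_finset (W ×ˢ Finset.univ) hf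
  obtain ⟨i, hi, him⟩ := hK.exists_dominant (hW.product Finset.univ_nonempty) hfK
  have hmem : ∀ ω ∈ W, ∀ b : Bool, (ω, b) ∈ W ×ˢ (Finset.univ : Finset Bool) := by
    intro ω hω b; simp [hω]
  rcases hK.eq_zero_or_isUnit (hfK i hi) with h0 | h0
  · rw [germ_eq_zero_iff] at h0
    intro ω hω
    filter_upwards [h0, him _ (hmem ω hω true), him _ (hmem ω hω false)] with x h1 h2 h3
    rw [h1, abs_zero, abs_nonpos_iff] at h2 h3
    exact ⟨h2, h3⟩
  exfalso
  obtain ⟨b, hb, hib⟩ := hK.exists_inv _ (hfK i hi) h0.ne_zero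
  have h0' := germ_isUnit_iff.1 h0
  have hlim : ∀ j ∈ W ×ˢ (Finset.univ : Finset Bool),
      ∃ l, Tendsto (fun x => f j x / f i x) atTop (nhds l) := by
    intro j hj
    refine hK.exists_tendsto (C := 1) ?_ ?_
    · have : ((fun x => f j x / f i x : ℝ → ℝ) : Germ (atTop : Filter ℝ) ℝ) = f j * b := by
        refine h0.mul_right_cancel ?_
        rw [mul_assoc, mul_comm b, hib, mul_one, ← Germ.coe_mul, Germ.coe_eq]
        filter_upwards [h0'] with x hx
        simp [hx]
      rw [this]
      exact mul_mem (hfK j hj) hb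
    · filter_upwards [him j hj] with x hx
      rw [abs_div]
      exact div_le_one_of_le₀ hx (abs_nonneg _)
  choose! l hl using hlim
  -- Replacing the quotients by the dominant germ with their limits changes the sum by a term
  -- tending to zero. The limit coefficients must then vanish, although the dominant germ itself
  -- contributes 1.
  have hz := eq_zero_of_tendsto_sum_exp W (fun ω => (l (ω, true) + l (ω, false) * Complex.I : ℂ)) ?_
  · have hli : l i = 1 := by
      refine tendsto_nhds_unique (hl i hi) (tendsto_const_nhds.congr' ?_)
      filter_upwards [h0'] with x hx
      rw [div_self hx]
    obtain ⟨ω, c⟩ := i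
    have hω : ω ∈ W := by simpa using hi
    have h1 := hz ω hω
    have hre := congrArg Complex.re h1
    have him := congrArg Complex.im h1
    simp at hre him
    rcases c with _ | _ <;> simp_all
  · have h1 : Tendsto (fun x : ℝ => ∑ ω ∈ W, Complex.exp (ω * x * Complex.I) *
        ((l (ω, true) + l (ω, false) * Complex.I : ℂ) - ((u ω x / f i x : ℝ) +
          (v ω x / f i x : ℝ) * Complex.I))) atTop (nhds (∑ ω ∈ W, 0)) := by
      refine tendsto_finsetSum _ fun ω hω => ?_
      have ht : Tendsto (fun x : ℝ => (l (ω, true) + l (ω, false) * Complex.I : ℂ) -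
          ((u ω x / f i x : ℝ) + (v ω x / f i x : ℝ) * Complex.I)) atTop (nhds 0) := by
        have h2 := (Complex.continuous_ofReal.tendsto _).comp (hl _ (hmem ω hω true))
        have h3 := (Complex.continuous_ofReal.tendsto _).comp (hl _ (hmem ω hω false))
        have h4 := (tendsto_const_nhds (x := (l (ω, true) + l (ω, false) * Complex.I : ℂ))).sub
          (h2.add (h3.mul_const Complex.I))
        simpa [f] using! h4
      rw [tendsto_zero_iff_norm_tendsto_zero] at ht ⊢
      refine ht.congr fun x => ?_
      rw [norm_mul, ← Complex.ofReal_mul, Complex.norm_exp_ofReal_mul_I, one_mul]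
    rw [Finset.sum_const_zero] at h1
    refine h1.congr' ?_
    filter_upwards [h] with x hx
    simp only [mul_sub, Finset.sum_sub_distrib, sub_eq_self]
    rw [← mul_zero (f i x : ℂ)⁻¹, ← hx, Finset.mul_sum]
    refine Finset.sum_congr rfl fun ω _ => ?_
    push_cast
    ring

/-! ### The `L²` Fourier transform of dilates and translates -/

/-- On `L²` the transform agrees with that of tempered distributions, which is defined by this
duality. -/
theorem integral_smul_fourier_Lp (ψ : SchwartzMap ℝ ℂ) (f : Lp ℂ 2 (volume : Measure ℝ)) :
    ∫ x, ψ x • (𝓕 f : Lp ℂ 2 (volume : Measure ℝ)) x = ∫ x, 𝓕 (ψ : ℝ → ℂ) x • f x := by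
  rw [← Lp.toTemperedDistribution_apply, ← Lp.fourier_toTemperedDistribution_eq,
    TemperedDistribution.fourier_apply, Lp.toTemperedDistribution_apply, SchwartzMap.fourier_coe]

/-- The `L²` Fourier transform is characterized by pairing with Schwartz functions. -/
theorem fourier_Lp_eq_of_integral_smul {f g : Lp ℂ 2 (volume : Measure ℝ)}
    (h : ∀ ψ : SchwartzMap ℝ ℂ, ∫ x, ψ x • g x = ∫ x, 𝓕 (ψ : ℝ → ℂ) x • f x) : 𝓕 f = g := by
  have hinj : Function.Injective (Lp.toTemperedDistributionCLM ℂ (volume : Measure ℝ) 2) :=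
    LinearMap.ker_eq_bot.1 (Lp.ker_toTemperedDistributionCLM_eq_bot (F := ℂ))
  apply hinj
  ext ψ
  rw [Lp.toTemperedDistributionCLM_apply, Lp.toTemperedDistributionCLM_apply,
    Lp.toTemperedDistribution_apply, Lp.toTemperedDistribution_apply, h,
    integral_smul_fourier_Lp]

/-- On `L¹ ∩ L²`, the `L²` Fourier transform is given by the Fourier integral. -/
theorem fourier_toLp_eq {f : ℝ → ℂ} (hf : Integrable f) (hf2 : MemLp f 2 volume)
    (hF : MemLp (𝓕 f) 2 volume) : 𝓕 (hf2.toLp f) = hF.toLp (𝓕 f) := by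
  refine fourier_Lp_eq_of_integral_smul fun ψ => ?_
  have h1 : ∫ x, ψ x • hF.toLp (𝓕 f) x = ∫ x, ψ x • 𝓕 f x :=
    integral_congr_ae (by filter_upwards [hF.coeFn_toLp] with x hx; rw [hx])
  have h2 : ∫ x, 𝓕 (ψ : ℝ → ℂ) x • hf2.toLp f x = ∫ x, 𝓕 (ψ : ℝ → ℂ) x • f x :=
    integral_congr_ae (by filter_upwards [hf2.coeFn_toLp] with x hx; rw [hx])
  rw [h1, h2]
  simpa using! (VectorFourier.integral_fourierIntegral_smul_eq_flip (L := innerₗ ℝ)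
    Real.continuous_fourierChar continuous_inner ψ.integrable hf).symm

theorem iteratedDeriv_cexp_mul_I (θ : ℝ) (n : ℕ) :
    iteratedDeriv n (fun x : ℝ => Complex.exp (θ * x * Complex.I)) =
      fun x : ℝ => (θ * Complex.I) ^ n * Complex.exp (θ * x * Complex.I) := by
  induction n with
  | zero => simp
  | succ n ih =>
    rw [iteratedDeriv_succ, ih]
    ext x
    have h1 : HasDerivAt (fun x : ℝ => (θ * x * Complex.I : ℂ)) (θ * Complex.I) x := by
      simpa using ((Complex.ofRealCLM.hasDerivAt (x := x)).const_mul (θ : ℂ)).mul_const Complex.I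
    rw [(h1.cexp.const_mul ((θ * Complex.I) ^ n)).deriv]
    ring

theorem hasTemperateGrowth_cexp_mul_I (θ : ℝ) :
    Function.HasTemperateGrowth fun x : ℝ => Complex.exp (θ * x * Complex.I) := by
  refine ⟨?_, fun n => ⟨0, |θ| ^ n, fun x => ?_⟩⟩
  · exact (((contDiff_const.mul Complex.ofRealCLM.contDiff).mul contDiff_const)).cexp
  · rw [norm_iteratedFDeriv_eq_norm_iteratedDeriv, iteratedDeriv_cexp_mul_I, norm_mul,
      ← Complex.ofReal_mul, Complex.norm_exp_ofReal_mul_I]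
    simp

theorem memLp_cexp_mul {F : ℝ → ℂ} (hF : MemLp F 2 volume) (θ : ℝ) :
    MemLp (fun x : ℝ => Complex.exp (θ * x * Complex.I) * F x) 2 volume := by
  refine hF.of_le (AEStronglyMeasurable.mul (by fun_prop) hF.1) (.of_forall fun x => ?_)
  rw [norm_mul, ← Complex.ofReal_mul, Complex.norm_exp_ofReal_mul_I, one_mul]

theorem integral_comp_mul_sub (H : ℝ → ℂ) {r : ℝ} (hr : 0 < r) (b : ℝ) :
    ∫ x, H (r * x - b) = (r : ℂ)⁻¹ * ∫ x, H x := by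
  rw [Measure.integral_comp_mul_left (fun y => H (y - b)) r, integral_sub_right_eq_self,
    abs_of_pos (inv_pos.2 hr), Complex.real_smul, Complex.ofReal_inv]

/-- Schwartz functions are stable under dilation and modulation, which correspond to dilation and
translation of the Fourier transform. -/
theorem exists_schwartz_dilate_modulate (ψ : SchwartzMap ℝ ℂ) {r : ℝ} (hr : 0 < r) (b : ℝ) :
    ∃ η : SchwartzMap ℝ ℂ,
      (∀ x : ℝ, η x = r * (Complex.exp ((-2 * Real.pi * b : ℝ) * x * Complex.I) * ψ (r * x))) ∧
      ∀ y : ℝ, 𝓕 (η : ℝ → ℂ) y = 𝓕 (ψ : ℝ → ℂ) ((y + b) / r) := by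
  let e : ℝ ≃L[ℝ] ℝ := ContinuousLinearEquiv.unitsEquivAut ℝ (Units.mk0 r hr.ne')
  refine ⟨(r : ℂ) • SchwartzMap.smulLeftCLM ℂ
    (fun x : ℝ => Complex.exp ((-2 * Real.pi * b : ℝ) * x * Complex.I))
    (SchwartzMap.compCLMOfContinuousLinearEquiv ℂ e ψ), ?_, ?_⟩
  all_goals
    have key : ∀ x : ℝ, ((r : ℂ) • SchwartzMap.smulLeftCLM ℂ
      (fun x : ℝ => Complex.exp ((-2 * Real.pi * b : ℝ) * x * Complex.I))
      (SchwartzMap.compCLMOfContinuousLinearEquiv ℂ e ψ)) x =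
      r * (Complex.exp ((-2 * Real.pi * b : ℝ) * x * Complex.I) * ψ (r * x)) := by
      intro x
      rw [smul_apply,
        SchwartzMap.smulLeftCLM_apply_apply (hasTemperateGrowth_cexp_mul_I _)]
      simp [e, mul_comm x]
  · exact key
  · intro y
    rw [Real.fourier_eq', Real.fourier_eq']
    simp_rw [key]
    have h := integral_comp_mul_sub (fun v => Complex.exp ((-2 * Real.pi *
      inner ℝ v ((y + b) / r) : ℝ) * Complex.I) • ψ v) hr 0
    rw [eq_inv_mul_iff_mul_eq₀ (by exact_mod_cast hr.ne')] at h
    rw [← h, ← integral_const_mul]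
    congr 1
    ext v
    have : Complex.exp ((-2 * Real.pi * inner ℝ (r * v - 0) ((y + b) / r) : ℝ) * Complex.I) =
        Complex.exp ((-2 * Real.pi * inner ℝ v y : ℝ) * Complex.I) *
        Complex.exp ((-2 * Real.pi * b : ℝ) * v * Complex.I) := by
      rw [← Complex.exp_add, ← Complex.ofReal_mul, ← add_mul, ← Complex.ofReal_add]
      congr 3
      simp only [RCLike.inner_apply, conj_trivial]
      field_simp
      ring
    rw [this, sub_zero]
    simp only [smul_eq_mul]
    ring

/-- The Fourier transform of a dilated and translated square-integrable function. -/
theorem fourier_waveletAtom (φ : Lp ℂ 2 (volume : Measure ℝ)) (s : Set.Ioi (0 : ℝ) × ℝ) :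
    (𝓕 (waveletAtom φ s) : Lp ℂ 2 (volume : Measure ℝ)) =ᵐ[volume] fun γ : ℝ =>
      ((s.1 : ℝ) : ℂ)⁻¹ * (Complex.exp ((-2 * Real.pi * s.2 / s.1 : ℝ) * γ * Complex.I) *
        (𝓕 φ : Lp ℂ 2 (volume : Measure ℝ)) ((s.1 : ℝ)⁻¹ * γ)) := by
  obtain ⟨⟨r, hr⟩, b⟩ := s
  simp only
  have hr : 0 < r := hr
  set F := (𝓕 φ : Lp ℂ 2 (volume : Measure ℝ)) with hFdef
  have hF := memLp_dilate_translate (Lp.memLp F) (inv_pos.2 hr) 0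
  simp only [sub_zero] at hF
  have hg := (memLp_cexp_mul hF (-2 * Real.pi * b / r)).const_mul (r : ℂ)⁻¹
  suffices h : 𝓕 (waveletAtom φ (⟨r, hr⟩, b)) = hg.toLp _ by
    rw [h]; exact hg.coeFn_toLp
  refine fourier_Lp_eq_of_integral_smul fun ψ => ?_
  have h1 : ∫ x, ψ x • hg.toLp _ x = ∫ x, ψ x • ((r : ℂ)⁻¹ *
      (Complex.exp ((-2 * Real.pi * b / r : ℝ) * x * Complex.I) * F (r⁻¹ * x))) :=
    integral_congr_ae (by filter_upwards [hg.coeFn_toLp] with x hx; rw [hx])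
  have h2 : ∫ x, 𝓕 (ψ : ℝ → ℂ) x • waveletAtom φ (⟨r, hr⟩, b) x =
      ∫ x, 𝓕 (ψ : ℝ → ℂ) x • φ (r * x - b) := by
    refine integral_congr_ae ?_
    filter_upwards [(memLp_dilate_translate (Lp.memLp φ) hr b).coeFn_toLp] with x hx
    rw [waveletAtom, hx]
  rw [h1, h2]
  -- Dilation and translation are moved from `φ` to the test function: up to the factor `r⁻¹`, the
  -- right side is the pairing of the transform of `η` with `φ`.
  obtain ⟨η, hη, hη'⟩ := exists_schwartz_dilate_modulate ψ hr b
  have h3 := integral_smul_fourier_Lp η φ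
  have h4 := integral_comp_mul_sub (fun y => 𝓕 (ψ : ℝ → ℂ) ((y + b) / r) • φ y) hr b
  have hr0 : (r : ℂ) ≠ 0 := by exact_mod_cast hr.ne'
  simp_rw [sub_add_cancel, mul_div_cancel_left₀ _ hr.ne', ← hη', ← h3] at h4
  rw [h4]
  have h5 := integral_comp_mul_sub (fun x => ψ x • ((r : ℂ)⁻¹ *
      (Complex.exp ((-2 * Real.pi * b / r : ℝ) * x * Complex.I) * F (r⁻¹ * x)))) hr 0
  rw [eq_inv_mul_iff_mul_eq₀ hr0] at h5
  rw [← h5, ← integral_const_mul, ← integral_const_mul]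
  congr 1
  ext x
  rw [hη, sub_zero, inv_mul_cancel_left₀ hr.ne', ← hFdef]
  have : ((-2 * Real.pi * b / r : ℝ) : ℂ) * ((r * x : ℝ) : ℂ) =
      ((-2 * Real.pi * b : ℝ) : ℂ) * x := by
    push_cast; field_simp
  rw [this]
  simp only [smul_eq_mul]
  field_simp

/-! ### Zeros of trigonometric polynomials and translates in `L²` -/

/-- A nonzero trigonometric polynomial has countably many zeros. -/
theorem countable_zeros_sum_exp (W : Finset ℝ) {z : ℝ → ℂ} {ν : ℝ} (hν : ν ∈ W) (hz : z ν ≠ 0) :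
    {x : ℝ | ∑ ω ∈ W, Complex.exp (ω * x * Complex.I) * z ω = 0}.Countable := by
  set p : ℝ → ℂ := fun x => ∑ ω ∈ W, Complex.exp (ω * x * Complex.I) * z ω with hp
  obtain ⟨x, hx⟩ : ∃ x, p x ≠ 0 := by
    by_contra! h
    refine hz (eq_zero_of_tendsto_sum_exp W z ?_ ν hν)
    exact tendsto_const_nhds.congr fun x => (h x).symm
  have han : AnalyticOnNhd ℝ p Set.univ := by
    intro x _
    refine Finset.analyticAt_fun_sum _ fun ω _ => ?_
    refine AnalyticAt.mul (AnalyticAt.fun_comp (analyticAt_cexp.restrictScalars (𝕜 := ℝ)) ?_)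
      analyticAt_const
    exact (analyticAt_const.mul (Complex.ofRealCLM.analyticAt x)).mul analyticAt_const
  -- By the identity principle the zeros form a discrete subset of `ℝ`, and such a set is countable.
  have hc := han.preimage_zero_mem_codiscrete hx
  have hd : DiscreteTopology ↑(p ⁻¹' {0} ∩ Set.univ) :=
    isDiscrete_iff_discreteTopology.mp
      (isDiscrete_of_codiscreteWithin (U := Set.univ) (s := p ⁻¹' {0}) (by simpa using! hc))
  rw [Set.inter_univ] at hd
  change (p ⁻¹' {0}).Countable
  exact TopologicalSpace.separableSpace_iff_countable.1 inferInstance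

theorem ae_comp_ne_zero_sum_exp (W : Finset ℝ) {z : ℝ → ℂ} {ν : ℝ} (hν : ν ∈ W) (hz : z ν ≠ 0)
    {g : ℝ → ℝ} (hg : Function.Injective g) :
    ∀ᵐ x : ℝ, ∑ ω ∈ W, Complex.exp (ω * g x * Complex.I) * z ω ≠ 0 := by
  have := (countable_zeros_sum_exp W hν hz).preimage_of_injOn (f := g) hg.injOn
  exact (measure_eq_zero_iff_ae_notMem).1 (this.measure_zero volume)

theorem sum_smul_Lp_eq_zero_iff {ι : Type*} (s : Finset ι) (c : ι → ℂ)
    {f : ι → Lp ℂ 2 (volume : Measure ℝ)} {g : ι → ℝ → ℂ} (hfg : ∀ i ∈ s, f i =ᵐ[volume] g i) :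
    ∑ i ∈ s, c i • f i = 0 ↔ ∀ᵐ x, ∑ i ∈ s, c i * g i x = 0 := by
  have h1 : ⇑(∑ i ∈ s, c i • f i) =ᵐ[volume] fun x => ∑ i ∈ s, c i * g i x := by
    refine (Lp.coeFn_finsetSum _ _).trans ?_
    have h2 : ∀ i ∈ s, ⇑(c i • f i) =ᵐ[volume] fun x => c i * g i x := by
      intro i hi
      filter_upwards [Lp.coeFn_smul (c i) (f i), hfg i hi] with x h3 h4
      rw [h3, Pi.smul_apply, h4, smul_eq_mul]
    filter_upwards [(ae_ball_iff s.countable_toSet).2 h2] with x hx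
    rw [Finset.sum_apply, Finset.sum_congr rfl hx]
  rw [Lp.eq_zero_iff_ae_eq_zero]
  exact ⟨fun h => h1.symm.trans h, fun h => h1.trans h⟩

theorem waveletAtom_coeFn {φ : Lp ℂ 2 (volume : Measure ℝ)} {f : ℝ → ℂ} (hf : φ =ᵐ[volume] f)
    (s : Set.Ioi (0 : ℝ) × ℝ) :
    waveletAtom φ s =ᵐ[volume] fun x => f ((s.1 : ℝ) * x - s.2) := by
  have hs : (s.1 : ℝ) ≠ 0 := (Set.mem_Ioi.1 s.1.2).ne'
  have hq : Measure.QuasiMeasurePreserving (fun x : ℝ => (s.1 : ℝ) * x - s.2) volume volume := by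
    refine (measurePreserving_sub_right (volume : Measure ℝ) s.2).quasiMeasurePreserving.comp
      (g := fun x => x - s.2) (f := fun x => (s.1 : ℝ) * x) ⟨by fun_prop, ?_⟩
    rw [Real.map_volume_mul_left hs]
    exact Measure.smul_absolutelyContinuous
  exact (memLp_dilate_translate (Lp.memLp φ) s.1.2 s.2).coeFn_toLp.trans (hq.ae_eq_comp hf)

theorem ae_sum_fourier_eq_zero {φ : Lp ℂ 2 (volume : Measure ℝ)}
    {Λ : Finset (Set.Ioi (0 : ℝ) × ℝ)} {c : Set.Ioi (0 : ℝ) × ℝ → ℂ}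
    (h : ∑ s ∈ Λ, c s • waveletAtom φ s = 0) :
    ∀ᵐ γ : ℝ, ∑ s ∈ Λ, c s * (((s.1 : ℝ) : ℂ)⁻¹ *
      (Complex.exp ((-2 * Real.pi * s.2 / s.1 : ℝ) * γ * Complex.I) *
        (𝓕 φ : Lp ℂ 2 (volume : Measure ℝ)) ((s.1 : ℝ)⁻¹ * γ))) = 0 := by
  refine (sum_smul_Lp_eq_zero_iff Λ c fun s _ => fourier_waveletAtom φ s).1 ?_
  have := congrArg (Lp.fourierTransformₗᵢ ℝ ℂ) h
  rw [map_sum, map_zero] at this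
  simpa only [map_smul] using! this

/-- Translates of a nonzero square-integrable function are linearly independent. -/
theorem ae_eq_zero_of_sum_translate {G : ℝ → ℂ} (hG : MemLp G 2 volume) (S : Finset ℝ)
    {c : ℝ → ℂ} {σ : ℝ} (hσ : σ ∈ S) (hc : c σ ≠ 0)
    (h : ∀ᵐ t, ∑ s ∈ S, c s * G (t - s) = 0) : G =ᵐ[volume] 0 := by
  let e : ℝ ↪ Set.Ioi (0 : ℝ) × ℝ := ⟨fun s => (⟨1, Set.mem_Ioi.2 one_pos⟩, s), fun s t h => by simpa using h⟩
  have he1 : ∀ s, ((e s).1 : ℝ) = 1 := fun s => rfl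
  have he2 : ∀ s, (e s).2 = s := fun s => rfl
  have h1 : ∑ s ∈ S.map e, c s.2 • waveletAtom (hG.toLp G) s = 0 := by
    rw [Finset.sum_map]
    refine (sum_smul_Lp_eq_zero_iff S c fun s _ => waveletAtom_coeFn hG.coeFn_toLp (e s)).2 ?_
    simpa only [he1, he2, one_mul] using h
  have h2 := ae_sum_fourier_eq_zero (c := fun s => c s.2) h1
  have hinj : Function.Injective fun γ : ℝ => -2 * Real.pi * γ :=
    mul_right_injective₀ (by simp [Real.pi_ne_zero])
  -- The transformed relation is a nonzero trigonometric polynomial times the transform of `G`, so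
  -- the latter vanishes off a countable set.
  have h3 : (𝓕 (hG.toLp G) : Lp ℂ 2 (volume : Measure ℝ)) = 0 := by
    rw [Lp.eq_zero_iff_ae_eq_zero]
    filter_upwards [h2, ae_comp_ne_zero_sum_exp S hσ hc hinj] with γ h4 h5
    refine (mul_eq_zero.1 ?_).resolve_left h5
    rw [← h4, Finset.sum_map, Finset.sum_mul]
    refine Finset.sum_congr rfl fun s _ => ?_
    have : ((-2 * Real.pi * s / (1 : ℝ) : ℝ) : ℂ) * γ * Complex.I =
        s * ((-2 * Real.pi * γ : ℝ) : ℂ) * Complex.I := by push_cast; ring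
    rw [he1, he2, this, inv_one, one_mul, Complex.ofReal_one, inv_one, one_mul]
    ring
  have h4 : hG.toLp G = 0 := by
    have := (Lp.fourierTransformₗᵢ ℝ ℂ).injective.eq_iff' (a := hG.toLp G) (map_zero _)
    exact this.1 h3
  exact hG.coeFn_toLp.symm.trans ((Lp.eq_zero_iff_ae_eq_zero).1 h4)

/-! ### Translation equations propagated downwards from `+∞` -/

/-- Each step of the recursion moves `u` upwards by at least `δ`, so `⌈(Y - u) / δ⌉₊` decreases
until the region where `G` is prescribed is reached. -/
theorem exists_downward_extension {S : Finset ℝ} {δ : ℝ} (hδ : 0 < δ) (hS : ∀ s ∈ S, δ ≤ s)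
    (d : ℝ → ℂ) (G : ℝ → ℂ) (Y : ℝ) :
    ∃ H : ℝ → ℂ, (∀ u, Y ≤ u → H u = G u) ∧ ∀ u < Y, H u = ∑ s ∈ S, d s * H (u + s) := by
  have hwf : WellFounded (InvImage (· < ·) fun u : ℝ => ⌈(Y - u) / δ⌉₊) :=
    InvImage.wf _ wellFounded_lt
  have hdec : ∀ u < Y, ∀ s ∈ S, ⌈(Y - (u + s)) / δ⌉₊ < ⌈(Y - u) / δ⌉₊ := by
    intro u hu s hs
    rw [Nat.lt_ceil]
    rcases le_or_gt (Y - (u + s)) 0 with h | h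
    · rw [Nat.ceil_eq_zero.2 (div_nonpos_of_nonpos_of_nonneg h hδ.le), Nat.cast_zero]
      exact div_pos (by linarith) hδ
    · refine (Nat.ceil_lt_add_one (div_pos h hδ).le).trans_le ?_
      rw [← div_self hδ.ne', ← add_div]
      have := hS s hs
      gcongr
      linarith
  let step : (u : ℝ) → ((v : ℝ) → InvImage (· < ·) (fun u : ℝ => ⌈(Y - u) / δ⌉₊) v u → ℂ) → ℂ :=
    fun u ih => if h : u < Y then ∑ s ∈ S.attach, d s * ih (u + s) (hdec u h s s.2) else G u
  refine ⟨hwf.fix step, fun u hu => ?_, fun u hu => ?_⟩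
  · rw [hwf.fix_eq]
    exact dif_neg hu.not_gt
  · rw [hwf.fix_eq]
    change dite _ _ _ = _
    rw [dif_pos hu]
    exact Finset.sum_attach S fun s => d s * hwf.fix step (u + s)

/-- Propagation of zeros downwards, along a translation-invariant filter. -/
theorem eventually_eq_zero_of_propagate {l : Filter ℝ} [CountableInterFilter l]
    (hl : ∀ s : ℝ, Tendsto (fun u => u + s) l l) {S : Finset ℝ} {δ : ℝ} (hδ : 0 < δ)
    (hS : ∀ s ∈ S, δ ≤ s) {D : ℝ → ℂ} {Y : ℝ} (hY : ∀ u, Y ≤ u → D u = 0)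
    (h : ∀ᶠ u in l, (∀ s ∈ S, D (u + s) = 0) → D u = 0) : ∀ᶠ u in l, D u = 0 := by
  -- The zero set grows by a strip of width `δ` at a time; countable intersections combine the
  -- strips.
  have hn : ∀ n : ℕ, ∀ᶠ u in l, Y - n * δ ≤ u → D u = 0 := by
    intro n
    induction n with
    | zero => exact .of_forall fun u hu => hY u (by simpa using hu)
    | succ n ih =>
      have h1 : ∀ᶠ u in l, ∀ s ∈ S, Y - n * δ ≤ u + s → D (u + s) = 0 :=
        (eventually_countable_ball S.countable_toSet).2 fun s _ => (hl s).eventually ih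
      filter_upwards [h, h1] with u h2 h3 hu
      refine h2 fun s hs => h3 s hs ?_
      push_cast at hu
      linarith [hS s hs]
  filter_upwards [eventually_countable_forall.2 hn] with u hu
  obtain ⟨n, hn⟩ := exists_nat_ge ((Y - u) / δ)
  rw [div_le_iff₀ hδ] at hn
  exact hu n (by linarith)

theorem exists_pos_le_of_finset {S : Finset ℝ} (hS : ∀ s ∈ S, 0 < s) :
    ∃ δ > 0, ∀ s ∈ S, δ ≤ s := by
  rcases S.eq_empty_or_nonempty with rfl | h
  · exact ⟨1, one_pos, by simp⟩
  · exact ⟨S.min' h, hS _ (S.min'_mem h), fun s hs => S.min'_le s hs⟩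

/-- A function satisfying an exponential-polynomial translation equation, whose individual
frequency components vanish near `+∞`, satisfies a translation equation with constant
coefficients, and vanishes if it is square-integrable with weight `exp t`. -/
theorem ae_eq_zero_of_sum_exp_translate {G : ℝ → ℂ}
    (hG : MemLp (fun t : ℝ => (Real.exp (t / 2) : ℂ) * G t) 2 volume)
    {S W : Finset ℝ} {c : ℝ → ℝ → ℂ} {σ ν X : ℝ} (hσ : σ ∈ S) (hmax : ∀ s ∈ S, s ≤ σ)
    (hν : ν ∈ W) (hc : c σ ν ≠ 0)
    (h : ∀ᵐ t : ℝ, ∑ ω ∈ W, Complex.exp (ω * Real.exp t * Complex.I) *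
      ∑ s ∈ S, c s ω * G (t - s) = 0)
    (hX : ∀ ω ∈ W, ∀ t, X ≤ t → ∑ s ∈ S, c s ω * G (t - s) = 0) : G =ᵐ[volume] 0 := by
  classical
  -- Solving the equation at `t` for the term with the largest shift `σ` expresses the value at `t -
  -- σ` through values at points further right by `σ - s > 0`.
  set S' : Finset ℝ := (S.erase σ).image fun s => σ - s with hS'
  have hpos : ∀ s ∈ S', 0 < s := by
    simp only [hS', Finset.mem_image, Finset.mem_erase]
    rintro _ ⟨s, ⟨h1, h2⟩, rfl⟩
    exact sub_pos.2 ((hmax s h2).lt_of_ne h1)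
  obtain ⟨δ, hδ, hδS⟩ := exists_pos_le_of_finset hpos
  have hsplit : ∀ (H : ℝ → ℂ) (a : ℝ → ℂ) (t : ℝ), ∑ s ∈ S, a s * H (t - s) =
      a σ * H (t - σ) + ∑ s ∈ S', a (σ - s) * H ((t - σ) + s) := by
    intro H a t
    rw [hS', Finset.sum_image (by simp), ← Finset.add_sum_erase S _ hσ]
    simp
  -- the extension of `G` from a neighbourhood of `+∞`
  obtain ⟨H, hHG, hH⟩ := exists_downward_extension hδ hδS
    (fun s => -(c σ ν)⁻¹ * c (σ - s) ν) G (X - σ)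
  have hHν : ∀ t, ∑ s ∈ S, c s ν * H (t - s) = 0 := by
    intro t
    rcases le_or_gt X t with ht | ht
    · rw [← hX ν hν t ht]
      refine Finset.sum_congr rfl fun s hs => ?_
      rw [hHG _ (by linarith [hmax s hs])]
    · rw [hsplit H (fun s => c s ν), hH (t - σ) (by linarith)]
      simp_rw [mul_assoc]
      rw [← Finset.mul_sum, neg_mul, mul_neg, mul_inv_cancel_left₀ hc, neg_add_cancel]
  have hprop : ∀ (D : ℝ → ℂ) (a : ℝ → ℂ) (t : ℝ), a σ ≠ 0 → ∑ s ∈ S, a s * D (t - s) = 0 →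
      (∀ s ∈ S', D ((t - σ) + s) = 0) → D (t - σ) = 0 := by
    intro D a t ha h0 hs
    rw [hsplit, Finset.sum_eq_zero (fun s hs' => by rw [hs s hs', mul_zero]), add_zero] at h0
    exact (mul_eq_zero.1 h0).resolve_left ha
  -- Constant-coefficient translation operators commute, so the `ω`-residual of `H` satisfies the
  -- `ν`-equation. It vanishes from `X` on and therefore, by the recursion, everywhere (hence the
  -- filter `⊤`).
  have hHω : ∀ ω ∈ W, ∀ t, ∑ s ∈ S, c s ω * H (t - s) = 0 := by
    intro ω hω
    have := eventually_eq_zero_of_propagate (l := ⊤) (fun s => tendsto_top) hδ hδS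
      (D := fun t => ∑ s ∈ S, c s ω * H (t - s)) (Y := X) ?_ ?_
    · simpa using this
    · intro t ht
      rw [← hX ω hω t ht]
      refine Finset.sum_congr rfl fun s hs => ?_
      rw [hHG _ (by linarith [hmax s hs])]
    · refine .of_forall fun u hu => ?_
      have h1 := hprop (fun t => ∑ s ∈ S, c s ω * H (t - s)) (fun s => c s ν) (u + σ) hc ?_ ?_
      · simpa using h1
      · simp_rw [Finset.mul_sum]
        rw [Finset.sum_comm]
        refine Finset.sum_eq_zero fun s _ => ?_
        rw [← mul_zero (c s ω), ← hHν (u + σ - s), Finset.mul_sum]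
        refine Finset.sum_congr rfl fun s' _ => ?_
        rw [sub_right_comm]; ring
      · simpa using hu
  -- Both `G` and `H` satisfy the mixed equation almost everywhere. Its leading coefficient is a
  -- nonzero trigonometric polynomial in `exp t`, so it can be solved for `G - H` outside a null
  -- set.
  have hD : ∀ᵐ u : ℝ, G u - H u = 0 := by
    refine eventually_eq_zero_of_propagate (fun s =>
      (measurePreserving_add_right (volume : Measure ℝ) s).quasiMeasurePreserving.tendsto_ae)
      hδ hδS (Y := X - σ) (fun u hu => by rw [hHG u hu, sub_self]) ?_
    have h1 : ∀ᵐ t : ℝ, (∀ s ∈ S', G ((t - σ) + s) - H ((t - σ) + s) = 0) →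
        G (t - σ) - H (t - σ) = 0 := by
      filter_upwards [h, ae_comp_ne_zero_sum_exp W (z := c σ) hν hc Real.exp_injective]
        with t h2 h3
      refine hprop (fun u => G u - H u)
        (fun s => ∑ ω ∈ W, Complex.exp (ω * Real.exp t * Complex.I) * c s ω) t h3 ?_
      simp_rw [Finset.sum_mul]
      rw [Finset.sum_comm, ← h2]
      refine Finset.sum_congr rfl fun ω hω => ?_
      rw [← sub_zero (∑ s ∈ S, c s ω * G (t - s)), ← hHω ω hω t, ← Finset.sum_sub_distrib,
        Finset.mul_sum]
      exact Finset.sum_congr rfl fun s _ => by ring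
    have h2 := (measurePreserving_add_right (volume : Measure ℝ) σ).quasiMeasurePreserving.ae h1
    simpa using h2
  have hGν : ∀ᵐ t : ℝ, ∑ s ∈ S, c s ν * G (t - s) = 0 := by
    have h1 : ∀ᵐ t : ℝ, ∀ s ∈ S, G (t - s) - H (t - s) = 0 :=
      (ae_ball_iff S.countable_toSet).2 fun s _ =>
        (measurePreserving_sub_right (volume : Measure ℝ) s).quasiMeasurePreserving.ae hD
    filter_upwards [h1] with t ht
    rw [← hHν t]
    exact Finset.sum_congr rfl fun s hs => by rw [sub_eq_zero.1 (ht s hs)]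
  -- The weight `exp (t / 2) = exp (s / 2) * exp ((t - s) / 2)` is compatible with translation and
  -- only rescales the coefficients.
  have hfin := ae_eq_zero_of_sum_translate hG S (c := fun s => c s ν * Real.exp (s / 2)) hσ
    (mul_ne_zero hc (by exact_mod_cast (Real.exp_pos _).ne')) (by
      filter_upwards [hGν] with t ht
      rw [← mul_zero (Real.exp (t / 2) : ℂ), ← ht, Finset.mul_sum]
      refine Finset.sum_congr rfl fun s _ => ?_
      have : (Real.exp (t / 2) : ℂ) = Real.exp (s / 2) * Real.exp ((t - s) / 2) := by
        rw [← Complex.ofReal_mul, ← Real.exp_add]; congr 2; ring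
      rw [this]; ring)
  filter_upwards [hfin] with t ht
  exact (mul_eq_zero.1 ht).resolve_left (by exact_mod_cast (Real.exp_pos _).ne')

/-! ### From dilation equations to translation equations -/

namespace IsLogExp

theorem comp_const_mul {f : ℝ → ℝ} (hf : IsLogExp f) {r : ℝ} (hr : 0 < r) :
    IsLogExp fun x => f (r * x) := by
  have ht : Tendsto (fun x : ℝ => r * x) atTop atTop := tendsto_id.const_mul_atTop hr
  induction hf with
  | const c => exact .const c
  | id => exact .mul (.const r) .id
  | add _ _ ihf ihg => exact .add ihf ihg
  | sub _ _ ihf ihg => exact .sub ihf ihg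
  | mul _ _ ihf ihg => exact .mul ihf ihg
  | div _ _ h0 ihf ihg => exact .div ihf ihg (ht.eventually h0)
  | exp _ ihf => exact .exp ihf
  | log _ h0 ihf => exact .log ihf (ht.eventually h0)

theorem sum {ι : Type*} (s : Finset ι) {f : ι → ℝ → ℝ} (hf : ∀ i ∈ s, IsLogExp (f i)) :
    IsLogExp fun x => ∑ i ∈ s, f i x := by
  classical
  induction s using Finset.induction_on with
  | empty => simpa using .const 0
  | insert i s hi ih =>
    simp_rw [Finset.sum_insert hi]
    exact .add (hf i (s.mem_insert_self i)) (ih fun j hj => hf j (Finset.mem_insert_of_mem hj))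

theorem eventually_continuousAt {f : ℝ → ℝ} (hf : IsLogExp f) :
    ∀ᶠ x in atTop, ContinuousAt f x := by
  obtain ⟨K, hK⟩ := _root_.exists_isHardyField
  obtain ⟨L, hL, -, hfL⟩ := hf.exists_isHardyField hK
  exact hL.eventually_continuousAt hfL

end IsLogExp

/-- The frequency components of an exponential-polynomial dilation equation for a function with
logarithmico-exponential germ vanish separately near `+∞`. -/
theorem eventually_sum_dilate_eq_zero {F : ℝ → ℂ} {u v : ℝ → ℝ} (hu : IsLogExp u)
    (hv : IsLogExp v) (hF : ∀ᶠ x in atTop, F x = u x + v x * Complex.I) {R W : Finset ℝ}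
    (hR : ∀ r ∈ R, 0 < r) {c : ℝ → ℝ → ℂ}
    (h : ∀ᵐ γ : ℝ, ∑ ω ∈ W, Complex.exp (ω * γ * Complex.I) *
      ∑ r ∈ R, c r ω * F (r⁻¹ * γ) = 0) :
    ∀ᶠ γ in atTop, ∀ ω ∈ W, ∑ r ∈ R, c r ω * F (r⁻¹ * γ) = 0 := by
  set U : ℝ → ℝ → ℝ := fun ω γ =>
    ∑ r ∈ R, ((c r ω).re * u (r⁻¹ * γ) - (c r ω).im * v (r⁻¹ * γ)) with hUdef
  set V : ℝ → ℝ → ℝ := fun ω γ =>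
    ∑ r ∈ R, ((c r ω).re * v (r⁻¹ * γ) + (c r ω).im * u (r⁻¹ * γ)) with hVdef
  have hU : ∀ ω, IsLogExp (U ω) := fun ω => .sum _ fun r hr =>
    .sub (.mul (.const _) (hu.comp_const_mul (inv_pos.2 (hR r hr))))
      (.mul (.const _) (hv.comp_const_mul (inv_pos.2 (hR r hr))))
  have hV : ∀ ω, IsLogExp (V ω) := fun ω => .sum _ fun r hr =>
    .add (.mul (.const _) (hv.comp_const_mul (inv_pos.2 (hR r hr))))
      (.mul (.const _) (hu.comp_const_mul (inv_pos.2 (hR r hr))))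
  have hFR : ∀ᶠ γ in atTop, ∀ r ∈ R, F (r⁻¹ * γ) = u (r⁻¹ * γ) + v (r⁻¹ * γ) * Complex.I := by
    rw [Filter.eventually_all_finset]
    exact fun r hr => (tendsto_id.const_mul_atTop (inv_pos.2 (hR r hr))).eventually hF
  have hUV : ∀ᶠ γ in atTop, ∀ ω,
      ∑ r ∈ R, c r ω * F (r⁻¹ * γ) = U ω γ + V ω γ * Complex.I := by
    filter_upwards [hFR] with γ hγ ω
    simp only [hUdef, hVdef, Complex.ofReal_sum, Finset.sum_mul, ← Finset.sum_add_distrib]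
    refine Finset.sum_congr rfl fun r hr => ?_
    rw [hγ r hr]
    conv_lhs => rw [← Complex.re_add_im (c r ω)]
    push_cast
    linear_combination (((c r ω).im : ℂ) * v (r⁻¹ * γ)) * Complex.I_mul_I
  have hcont : ∀ᶠ γ in atTop, ∀ ω ∈ W, ContinuousAt (U ω) γ ∧ ContinuousAt (V ω) γ := by
    rw [Filter.eventually_all_finset]
    exact fun ω _ => (hU ω).eventually_continuousAt.and (hV ω).eventually_continuousAt
  obtain ⟨X, hX⟩ := eventually_atTop.1 (hUV.and hcont)
  -- LE functions are ultimately continuous, so an identity valid almost everywhere holds at every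
  -- point beyond `X`.
  have hzero : Set.EqOn (fun γ : ℝ => ∑ ω ∈ W, Complex.exp (ω * γ * Complex.I) *
      (U ω γ + V ω γ * Complex.I)) (fun _ => 0) (Set.Ioi X) := by
    refine Measure.eqOn_open_of_ae_eq (μ := volume) ?_ isOpen_Ioi ?_ continuousOn_const
    · rw [Filter.EventuallyEq, ae_restrict_iff' measurableSet_Ioi]
      filter_upwards [h] with γ hγ hγX
      rw [← hγ]
      refine Finset.sum_congr rfl fun ω _ => ?_
      rw [(hX γ (le_of_lt hγX)).1 ω]
    · intro γ hγ
      refine ContinuousAt.continuousWithinAt ?_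
      refine tendsto_finsetSum _ fun ω hω => ?_
      have hc := (hX γ (le_of_lt hγ)).2 ω hω
      refine ContinuousAt.mul (by fun_prop) ?_
      exact (Complex.continuous_ofReal.continuousAt.comp hc.1).add
        ((Complex.continuous_ofReal.continuousAt.comp hc.2).mul continuousAt_const)
  have hfin := eventually_eq_zero_of_sum_exp W hU hV
    ((eventually_gt_atTop X).mono fun γ hγ => hzero hγ)
  rw [← Filter.eventually_all_finset] at hfin
  filter_upwards [hfin, hUV] with γ h1 h2 ω hω
  rw [h2 ω, (h1 ω hω).1, (h1 ω hω).2]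
  simp

/-- The preimage of a null set is the image of its positive part under `log`, which is
differentiable there and so preserves null sets. -/
theorem ae_comp_exp {P : ℝ → Prop} (h : ∀ᵐ x, P x) : ∀ᵐ t, P (Real.exp t) := by
  rw [ae_iff] at h ⊢
  have h1 : volume ({x | ¬ P x} ∩ Set.Ioi 0) = 0 := measure_mono_null Set.inter_subset_left h
  have h2 := addHaar_image_eq_zero_of_differentiableOn_of_addHaar_eq_zero volume
    (f := Real.log) (fun x hx => (Real.differentiableAt_log
      (ne_of_gt hx.2)).differentiableWithinAt) h1
  refine measure_mono_null (fun t ht => ?_) h2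
  exact ⟨Real.exp t, ⟨ht, Real.exp_pos t⟩, Real.log_exp t⟩

theorem ae_of_ae_comp_exp {P : ℝ → Prop} (h : ∀ᵐ t, P (Real.exp t)) :
    ∀ᵐ x : ℝ, 0 < x → P x := by
  rw [ae_iff] at h ⊢
  have h2 := addHaar_image_eq_zero_of_differentiableOn_of_addHaar_eq_zero volume
    Real.differentiable_exp.differentiableOn h
  refine measure_mono_null (fun x hx => ?_) h2
  simp only [Set.mem_ofPred_eq, Classical.not_imp] at hx
  exact ⟨Real.log x, by simpa [Real.exp_log hx.1] using hx.2, Real.exp_log hx.1⟩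

/-- The square of the weight `exp (t / 2)` is the Jacobian of the substitution `x = exp t`. -/
theorem memLp_exp_mul_comp_exp {F : ℝ → ℂ} (hF : MemLp F 2 volume) :
    MemLp (fun t : ℝ => (Real.exp (t / 2) : ℂ) * F (Real.exp t)) 2 volume := by
  have hq : Measure.QuasiMeasurePreserving Real.exp volume volume := by
    refine ⟨Real.measurable_exp, Measure.AbsolutelyContinuous.mk fun s hs h0 => ?_⟩
    rw [Measure.map_apply Real.measurable_exp hs]
    have := ae_comp_exp (P := fun x => x ∉ s) (measure_eq_zero_iff_ae_notMem.1 h0)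
    exact measure_eq_zero_iff_ae_notMem.2 this
  have hm : AEStronglyMeasurable (fun t : ℝ => (Real.exp (t / 2) : ℂ) * F (Real.exp t)) volume :=
    AEStronglyMeasurable.mul (by fun_prop) (hF.1.comp_quasiMeasurePreserving hq)
  rw [memLp_two_iff_integrable_sq_norm hm]
  have h1 := (memLp_two_iff_integrable_sq_norm hF.1).1 hF
  have h2 := (integrableOn_image_iff_integrableOn_abs_deriv_smul (s := Set.univ) MeasurableSet.univ
    (fun x _ => (Real.hasDerivAt_exp x).hasDerivWithinAt) Real.exp_injective.injOn
    (fun x => ‖F x‖ ^ 2)).1 h1.integrableOn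
  rw [integrableOn_univ] at h2
  refine h2.congr (.of_forall fun t => ?_)
  simp only [norm_mul, mul_pow, Complex.norm_real, Real.norm_eq_abs, Real.abs_exp, smul_eq_mul]
  rw [← Real.exp_nat_mul]
  congr 2
  push_cast
  ring

/-- A square-integrable function with logarithmico-exponential germ at `+∞` that satisfies a
nontrivial exponential-polynomial dilation equation vanishes on the positive half-line. -/
theorem ae_pos_eq_zero_of_sum_exp_dilate {ι : Type*} {Λ : Finset ι} {r w : ι → ℝ}
    (hr : ∀ i, 0 < r i) (hinj : Set.InjOn (fun i => (r i, w i)) Λ) {c : ι → ℂ} {i₀ : ι}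
    (hi₀ : i₀ ∈ Λ) (hc : c i₀ ≠ 0) {F : ℝ → ℂ} (hF2 : MemLp F 2 volume) {u v : ℝ → ℝ}
    (hu : IsLogExp u) (hv : IsLogExp v) (hF : ∀ᶠ x in atTop, F x = u x + v x * Complex.I)
    (h : ∀ᵐ γ : ℝ, ∑ i ∈ Λ, c i * (Complex.exp (w i * γ * Complex.I) * F ((r i)⁻¹ * γ)) = 0) :
    ∀ᵐ γ : ℝ, 0 < γ → F γ = 0 := by
  classical
  -- only the indices with nonzero coefficient matter
  set Λ' := Λ.filter fun i => c i ≠ 0 with hΛ'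
  have hi₀' : i₀ ∈ Λ' := by simp [hΛ', hi₀, hc]
  obtain ⟨i₁, hi₁, hmax⟩ := Λ'.exists_max_image r ⟨i₀, hi₀'⟩
  set R := Λ'.image r with hRdef
  set W := Λ'.image w with hWdef
  -- The coefficients are spread over the full grid of dilations and frequencies, with zeros at
  -- absent pairs. By injectivity the entry at `(r i₁, w i₁)` is just `c i₁`; there `r i₁` is
  -- maximal and becomes the largest shift `σ`.
  set C : ℝ → ℝ → ℂ := fun ρ ω =>
    ∑ i ∈ Λ', if r i = ρ then (if w i = ω then c i else 0) else 0 with hC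
  have hR : ∀ ρ ∈ R, 0 < ρ := by
    intro ρ hρ
    obtain ⟨i, -, rfl⟩ := Finset.mem_image.1 hρ
    exact hr i
  have hC₁ : C (r i₁) (w i₁) ≠ 0 := by
    have : C (r i₁) (w i₁) = c i₁ := by
      rw [hC]
      simp only
      rw [Finset.sum_eq_single_of_mem i₁ hi₁]
      · simp
      · intro j hj hji
        rw [← ite_and, if_neg]
        rintro ⟨h1, h2⟩
        exact hji (hinj (Finset.mem_filter.1 hj).1 (Finset.mem_filter.1 hi₁).1 (Prod.ext h1 h2))
    rw [this]
    exact (Finset.mem_filter.1 hi₁).2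
  have hsum : ∀ γ : ℝ, ∑ ω ∈ W, Complex.exp (ω * γ * Complex.I) *
      ∑ ρ ∈ R, C ρ ω * F (ρ⁻¹ * γ) =
      ∑ i ∈ Λ, c i * (Complex.exp (w i * γ * Complex.I) * F ((r i)⁻¹ * γ)) := by
    intro γ
    have h1 : ∑ i ∈ Λ, c i * (Complex.exp (w i * γ * Complex.I) * F ((r i)⁻¹ * γ)) =
        ∑ i ∈ Λ', c i * (Complex.exp (w i * γ * Complex.I) * F ((r i)⁻¹ * γ)) := by
      refine (Finset.sum_subset (Finset.filter_subset _ _) fun i hi hi' => ?_).symm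
      have : c i = 0 := by simpa [hi] using hi'
      rw [this, zero_mul]
    rw [h1]
    simp only [hC, Finset.sum_mul, Finset.mul_sum]
    rw [Finset.sum_congr rfl fun ω _ => Finset.sum_comm, Finset.sum_comm]
    refine Finset.sum_congr rfl fun i hi => ?_
    rw [Finset.sum_eq_single_of_mem (w i) (Finset.mem_image_of_mem w hi),
      Finset.sum_eq_single_of_mem (r i) (Finset.mem_image_of_mem r hi)]
    · simp; ring
    · intro ρ _ hρ
      simp [hρ.symm]
    · intro ω _ hω
      simp [hω.symm]
  have h' : ∀ᵐ γ : ℝ, ∑ ω ∈ W, Complex.exp (ω * γ * Complex.I) *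
      ∑ ρ ∈ R, C ρ ω * F (ρ⁻¹ * γ) = 0 := by
    simpa only [hsum] using h
  obtain ⟨X, hX⟩ := eventually_atTop.1
    (Real.tendsto_exp_atTop.eventually (eventually_sum_dilate_eq_zero hu hv hF hR h'))
  have hlog : ∀ (t : ℝ) (ω : ℝ), ∑ s ∈ R.image Real.log, C (Real.exp s) ω * F (Real.exp (t - s)) =
      ∑ ρ ∈ R, C ρ ω * F (ρ⁻¹ * Real.exp t) := by
    intro t ω
    rw [Finset.sum_image fun a ha b hb hab => Real.log_injOn_pos (hR a ha) (hR b hb) hab]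
    refine Finset.sum_congr rfl fun ρ hρ => ?_
    rw [Real.exp_log (hR ρ hρ), Real.exp_sub, Real.exp_log (hR ρ hρ), inv_mul_eq_div]
  refine ae_of_ae_comp_exp (P := fun x => F x = 0) ?_
  refine ae_eq_zero_of_sum_exp_translate (G := fun t => F (Real.exp t))
    (memLp_exp_mul_comp_exp hF2) (S := R.image Real.log) (W := W)
    (c := fun s ω => C (Real.exp s) ω) (σ := Real.log (r i₁)) (ν := w i₁) (X := X)
    (Finset.mem_image_of_mem _ (Finset.mem_image_of_mem _ hi₁)) ?_
    (Finset.mem_image_of_mem _ hi₁) (by rwa [Real.exp_log (hr i₁)]) ?_ ?_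
  · simp only [hRdef, Finset.mem_image]
    rintro _ ⟨_, ⟨i, hi, rfl⟩, rfl⟩
    exact Real.log_le_log (hr i) (hmax i hi)
  · simp_rw [hlog]
    exact ae_comp_exp h'
  · intro ω hω t ht
    rw [hlog]
    exact hX t ht ω hω

/-! ### Independence when the Fourier transform is an LE combination -/

theorem finiteWaveletSystemsIndependent_of_forall {φ : Lp ℂ 2 (volume : Measure ℝ)}
    (h : ∀ (Λ : Finset (Set.Ioi (0 : ℝ) × ℝ)) (c : Set.Ioi (0 : ℝ) × ℝ → ℂ),
      ∑ s ∈ Λ, c s • waveletAtom φ s = 0 → ∀ s ∈ Λ, c s = 0) :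
    FiniteWaveletSystemsIndependent φ :=
  fun Λ => linearIndepOn_finset_iff.2 fun c hc => h Λ c hc

theorem exists_isLogExp_sum {m : ℕ} (a : Fin m → ℂ) {f : Fin m → ℝ → ℝ}
    (hf : ∀ j, HasLEGerm (f j)) :
    ∃ u v : ℝ → ℝ, IsLogExp u ∧ IsLogExp v ∧
      ∀ᶠ x in atTop, ∑ j, a j * (f j x : ℂ) = u x + v x * Complex.I := by
  choose g hg hfg using hf
  refine ⟨fun x => ∑ j, (a j).re * g j x, fun x => ∑ j, (a j).im * g j x,
    .sum _ fun j _ => .mul (.const _) (hg j), .sum _ fun j _ => .mul (.const _) (hg j), ?_⟩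
  filter_upwards [eventually_all.2 hfg] with x hx
  push_cast
  rw [Finset.sum_mul, ← Finset.sum_add_distrib]
  refine Finset.sum_congr rfl fun j _ => ?_
  rw [hx j]
  conv_lhs => rw [← Complex.re_add_im (a j)]
  ring

theorem ae_comp_const_mul {P : ℝ → Prop} (h : ∀ᵐ x, P x) {r : ℝ} (hr : r ≠ 0) :
    ∀ᵐ x, P (r * x) := by
  have hq : Measure.QuasiMeasurePreserving (fun x : ℝ => r * x) volume volume := by
    refine ⟨by fun_prop, ?_⟩
    rw [Real.map_volume_mul_left hr]
    exact Measure.smul_absolutelyContinuous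
  exact hq.ae h

theorem IsLECombination.finiteWaveletSystemsIndependent {φ : Lp ℂ 2 (volume : Measure ℝ)}
    (hφ : φ ≠ 0) (h : IsLECombination (𝓕 φ : Lp ℂ 2 (volume : Measure ℝ))) :
    FiniteWaveletSystemsIndependent φ := by
  refine finiteWaveletSystemsIndependent_of_forall fun Λ c hsum => ?_
  obtain ⟨m, a, f, hf, hF⟩ := h
  set F : ℝ → ℂ := fun x => ∑ j, a j * (f j x : ℂ) with hFdef
  have hF2 : MemLp F 2 volume := (memLp_congr_ae hF).1 (Lp.memLp _)
  by_contra! hne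
  obtain ⟨s₀, hs₀, hc₀⟩ := hne
  have hr : ∀ s : Set.Ioi (0 : ℝ) × ℝ, 0 < (s.1 : ℝ) := fun s => s.1.2
  have heq : ∀ᵐ γ : ℝ, ∑ s ∈ Λ, (c s * ((s.1 : ℝ) : ℂ)⁻¹) *
      (Complex.exp ((-2 * Real.pi * s.2 / s.1 : ℝ) * γ * Complex.I) * F ((s.1 : ℝ)⁻¹ * γ)) = 0 := by
    have h1 : ∀ᵐ γ : ℝ, ∀ s ∈ Λ, (𝓕 φ : Lp ℂ 2 (volume : Measure ℝ)) ((s.1 : ℝ)⁻¹ * γ) =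
        F ((s.1 : ℝ)⁻¹ * γ) := (ae_ball_iff Λ.countable_toSet).2 fun s _ =>
      ae_comp_const_mul hF (inv_ne_zero (hr s).ne')
    filter_upwards [ae_sum_fourier_eq_zero hsum, h1] with γ h2 h3
    rw [← h2]
    refine Finset.sum_congr rfl fun s hs => ?_
    rw [h3 s hs, mul_assoc]
  -- The value `ε = -1` serves the negative half-line, where reflection reverses the frequencies.
  have hinj : ∀ ε : ℝ, ε ≠ 0 → Set.InjOn (fun s : Set.Ioi (0 : ℝ) × ℝ =>
      ((s.1 : ℝ), ε * (-2 * Real.pi * s.2 / s.1))) Λ := by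
    rintro ε hε ⟨⟨r, hr⟩, b⟩ - ⟨⟨r', hr'⟩, b'⟩ - heq
    obtain ⟨h1, h2⟩ := Prod.ext_iff.1 heq
    simp only at h1 h2
    subst h1
    have hr0 : r ≠ 0 := (Set.mem_Ioi.1 hr).ne'
    have hpi := Real.pi_ne_zero
    field_simp at h2
    simp [neg_inj.1 h2]
  have hc₀' : c s₀ * ((s₀.1 : ℝ) : ℂ)⁻¹ ≠ 0 :=
    mul_ne_zero hc₀ (inv_ne_zero (by exact_mod_cast (hr s₀).ne'))
  obtain ⟨u, v, hu, hv, hgerm⟩ := exists_isLogExp_sum a fun j => (hf j).2.1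
  have hpos := ae_pos_eq_zero_of_sum_exp_dilate hr (by simpa using hinj 1 one_ne_zero) hs₀
    (c := fun s => c s * ((s.1 : ℝ) : ℂ)⁻¹) hc₀' hF2 hu hv hgerm heq
  obtain ⟨u', v', hu', hv', hgerm'⟩ := exists_isLogExp_sum a fun j => (hf j).2.2
  have hneg := ae_pos_eq_zero_of_sum_exp_dilate hr (hinj (-1) (by norm_num)) hs₀
    (c := fun s => c s * ((s.1 : ℝ) : ℂ)⁻¹) hc₀' (F := fun x => F (-x))
    (hF2.comp_measurePreserving (Measure.measurePreserving_neg volume)) hu' hv' hgerm' (by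
      filter_upwards [ae_comp_const_mul heq (r := -1) (by norm_num)] with γ hγ
      rw [← hγ]
      refine Finset.sum_congr rfl fun s _ => ?_
      congr 2
      · congr 2; push_cast; ring
      · congr 1; ring)
  have hF0 : (𝓕 φ : Lp ℂ 2 (volume : Measure ℝ)) = 0 := by
    rw [Lp.eq_zero_iff_ae_eq_zero]
    refine hF.trans ?_
    filter_upwards [hpos, ae_comp_const_mul hneg (r := -1) (by norm_num),
      Measure.ae_ne volume (0 : ℝ)] with γ h1 h2 h3
    rcases lt_or_gt_of_ne h3 with h | h
    · simpa using h2 (by linarith)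
    · exact h1 h
  exact hφ (((Lp.fourierTransformₗᵢ ℝ ℂ).injective.eq_iff' (a := φ) (map_zero _)).1 hF0)

/-! ### Square-integrable rational functions -/

theorem not_memLp_polynomial {p : Polynomial ℂ} (hp : p ≠ 0) :
    ¬ MemLp (fun x : ℝ => p.eval (x : ℂ)) 2 volume := by
  intro h
  obtain ⟨ε, hε, X, hX⟩ : ∃ ε > 0, ∃ X : ℝ, ∀ x ≥ X, ε ≤ ‖p.eval (x : ℂ)‖ := by
    rcases Nat.eq_zero_or_pos p.natDegree with h0 | h0
    · rw [Polynomial.eq_C_of_natDegree_eq_zero h0] at hp ⊢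
      exact ⟨‖p.coeff 0‖, by simpa using hp, 0, by simp⟩
    · have ht : Tendsto (fun x : ℝ => ‖p.eval (x : ℂ)‖) atTop atTop := by
        refine p.tendsto_norm_atTop (Polynomial.natDegree_pos_iff_degree_pos.1 h0) ?_
        simpa using tendsto_abs_atTop_atTop
      exact ⟨1, one_pos, eventually_atTop.1 (ht.eventually_ge_atTop 1)⟩
  have h1 : MemLp (fun _ : ℝ => ε) 2 (volume.restrict (Set.Ici X)) := by
    refine (h.restrict (Set.Ici X)).norm.mono' (by fun_prop) ?_
    rw [ae_restrict_iff' measurableSet_Ici]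
    refine .of_forall fun x hx => ?_
    rw [Real.norm_of_nonneg hε.le]
    exact hX x hx
  rw [memLp_const_iff (by simp) (by simp)] at h1
  simp [hε.ne'] at h1

/-- An `L²` function is integrable on bounded intervals, but near `x₀` the quotient dominates `1 /
(x - x₀)`, which is not. -/
theorem not_memLp_rational_of_real_root {p q : Polynomial ℂ} {x₀ : ℝ} (hq0 : q ≠ 0)
    (hq : q.eval (x₀ : ℂ) = 0) (hp : p.eval (x₀ : ℂ) ≠ 0) :
    ¬ MemLp (fun x : ℝ => p.eval (x : ℂ) / q.eval (x : ℂ)) 2 volume := by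
  intro h
  obtain ⟨g, rfl⟩ := Polynomial.dvd_iff_isRoot.2 hq
  have hg0 : g ≠ 0 := right_ne_zero_of_mul hq0
  have hint : IntervalIntegrable (fun x : ℝ => p.eval (x : ℂ) /
      ((Polynomial.X - Polynomial.C (x₀ : ℂ)) * g).eval (x : ℂ)) volume (x₀ - 1) (x₀ + 1) := by
    rw [intervalIntegrable_iff, Set.uIoc_of_le (by linarith)]
    exact (h.restrict _).integrable (by norm_num)
  refine not_intervalIntegrable_of_sub_inv_isBigO_punctured (c := x₀) ?_ (by linarith)
    (by rw [Set.mem_uIcc]; left; constructor <;> linarith) hint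
  have hpc : ContinuousAt (fun x : ℝ => p.eval (x : ℂ)) x₀ := by fun_prop
  have hgc : ContinuousAt (fun x : ℝ => g.eval (x : ℂ)) x₀ := by fun_prop
  have hbound : (fun x : ℝ => g.eval (x : ℂ) / p.eval (x : ℂ)) =O[nhdsWithin x₀ {x₀}ᶜ]
      fun _ => (1 : ℂ) :=
    ((hgc.div₀ hpc hp).isBigO_one ℂ).mono nhdsWithin_le_nhds
  have hgne : ∀ᶠ x : ℝ in nhdsWithin x₀ {x₀}ᶜ, g.eval (x : ℂ) ≠ 0 := by
    have hfin : {x : ℝ | g.eval (x : ℂ) = 0}.Finite := by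
      have := (g.rootSet_finite ℂ).preimage (f := Complex.ofReal)
        Complex.ofReal_injective.injOn
      refine this.subset fun x hx => ?_
      simpa [Polynomial.mem_rootSet, hg0] using hx
    have h1 : ({x : ℝ | g.eval (x : ℂ) = 0} \ {x₀})ᶜ ∈ nhds x₀ :=
      (hfin.subset Set.sdiff_subset).isClosed.isOpen_compl.mem_nhds (by simp)
    filter_upwards [nhdsWithin_le_nhds h1, self_mem_nhdsWithin] with x hx hx0 h0
    exact hx ⟨h0, hx0⟩
  have hb := (Asymptotics.isBigO_refl (fun x : ℝ => p.eval (x : ℂ) /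
      ((Polynomial.X - Polynomial.C (x₀ : ℂ)) * g).eval (x : ℂ)) (nhdsWithin x₀ {x₀}ᶜ)).mul hbound
  simp only [mul_one] at hb
  refine Asymptotics.IsBigO.trans (Asymptotics.IsBigO.of_bound 1 ?_) hb
  filter_upwards [hgne, nhdsWithin_le_nhds (hpc.eventually_ne hp), self_mem_nhdsWithin]
    with x h1 h2 h3
  have h4 : ((x : ℂ) - x₀) ≠ 0 := by
    rw [← Complex.ofReal_sub]
    exact_mod_cast sub_ne_zero.2 h3
  have : p.eval (x : ℂ) / ((Polynomial.X - Polynomial.C (x₀ : ℂ)) * g).eval (x : ℂ) *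
      (g.eval (x : ℂ) / p.eval (x : ℂ)) = (((x - x₀)⁻¹ : ℝ) : ℂ) := by
    simp only [Polynomial.eval_mul, Polynomial.eval_sub, Polynomial.eval_X, Polynomial.eval_C]
    push_cast
    field_simp
  rw [this, Complex.norm_real, one_mul]

theorem exists_isCoprime_div_ae_eq (p q : Polynomial ℂ) (hq : q ≠ 0) :
    ∃ p' q' : Polynomial ℂ, q' ≠ 0 ∧ IsCoprime p' q' ∧
      (fun x : ℝ => p.eval (x : ℂ) / q.eval (x : ℂ)) =ᵐ[volume]
        fun x : ℝ => p'.eval (x : ℂ) / q'.eval (x : ℂ) := by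
  set g := EuclideanDomain.gcd p q with hg
  have hg0 : g ≠ 0 := fun h => hq (EuclideanDomain.gcd_eq_zero_iff.1 h).2
  obtain ⟨p', hp'⟩ := EuclideanDomain.gcd_dvd_left p q
  obtain ⟨q', hq'⟩ := EuclideanDomain.gcd_dvd_right p q
  rw [← hg] at hp' hq'
  refine ⟨p', q', fun h => hq (by rw [hq', h, mul_zero]), ?_, ?_⟩
  · refine ⟨EuclideanDomain.gcdA p q, EuclideanDomain.gcdB p q, mul_left_cancel₀ hg0 ?_⟩
    have := EuclideanDomain.gcd_eq_gcd_ab p q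
    rw [← hg] at this
    conv_rhs => rw [mul_one, this]
    linear_combination -(EuclideanDomain.gcdA p q) * hp' - (EuclideanDomain.gcdB p q) * hq'
  · have hfin : {x : ℝ | g.eval (x : ℂ) = 0}.Finite := by
      have := (g.rootSet_finite ℂ).preimage (f := Complex.ofReal)
        Complex.ofReal_injective.injOn
      refine this.subset fun x hx => ?_
      simpa [Polynomial.mem_rootSet, hg0] using hx
    filter_upwards [measure_eq_zero_iff_ae_notMem.1 (hfin.measure_zero volume)] with x hx
    rw [hp', hq', Polynomial.eval_mul, Polynomial.eval_mul, mul_div_mul_left _ _ hx]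

theorem finiteWaveletSystemsIndependent_of_rational {φ : Lp ℂ 2 (volume : Measure ℝ)}
    {p q : Polynomial ℂ} (hφ : φ ≠ 0)
    (h : φ =ᵐ[volume] fun x : ℝ => p.eval (x : ℂ) / q.eval (x : ℂ)) :
    FiniteWaveletSystemsIndependent φ := by
  classical
  have hq0 : q ≠ 0 := by
    rintro rfl
    exact hφ ((Lp.eq_zero_iff_ae_eq_zero).2 (h.trans (by simp; rfl)))
  obtain ⟨p', q', hq', hcop, he⟩ := exists_isCoprime_div_ae_eq p q hq0
  replace h := h.trans he
  clear he hq0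
  have hmem := (memLp_congr_ae h).1 (Lp.memLp φ)
  have hp' : p' ≠ 0 := by
    rintro rfl
    exact hφ ((Lp.eq_zero_iff_ae_eq_zero).2 (h.trans (by simp; rfl)))
  have hroot : ∀ z, q'.eval z = 0 → p'.eval z ≠ 0 := by
    intro z hz hpz
    obtain ⟨a, b, hab⟩ := hcop
    have := congrArg (Polynomial.eval z) hab
    simp [hz, hpz] at this
  have hreal : ∀ x : ℝ, q'.eval (x : ℂ) ≠ 0 := fun x hx =>
    not_memLp_rational_of_real_root hq' hx (hroot _ hx) hmem
  -- Without poles the function would be a nonzero polynomial, which is not square-integrable.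
  have hne : q'.roots.toFinset.Nonempty := by
    rw [Multiset.toFinset_nonempty]
    intro h0
    have hdeg : q'.natDegree = 0 := by
      rw [← IsAlgClosed.card_roots_eq_natDegree, h0, Multiset.card_zero]
    rw [Polynomial.eq_C_of_natDegree_eq_zero hdeg] at hmem hq'
    have hc : q'.coeff 0 ≠ 0 := by simpa using hq'
    refine not_memLp_polynomial hp' ?_
    have := hmem.const_mul (q'.coeff 0)
    refine (memLp_congr_ae (.of_forall fun x => ?_)).1 this
    simp only [Polynomial.eval_C]
    field_simp
  -- The pole is farthest from the real axis and, among those, rightmost. The wavelet `s₀` chosen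
  -- below has the smallest dilation and, among those, the largest translation, so its copy of `z`
  -- is a pole of no other wavelet.
  obtain ⟨z, hz, hzmax⟩ := q'.roots.toFinset.exists_max_image
    (fun z => toLex (|z.im|, z.re)) hne
  have hz0 : q'.eval z = 0 := by simpa [hq'] using hz
  have hzim : 0 < |z.im| := by
    rw [abs_pos]
    intro h0
    refine hreal z.re ?_
    rwa [show ((z.re : ℝ) : ℂ) = z from Complex.ext (by simp) (by simp [h0])]
  have hzmax' : ∀ y, q'.eval y = 0 → |y.im| < |z.im| ∨ (|y.im| = |z.im| ∧ y.re ≤ z.re) := by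
    intro y hy
    have := hzmax y (by simpa [hq'] using hy)
    rwa [Prod.Lex.toLex_le_toLex] at this
  refine finiteWaveletSystemsIndependent_of_forall fun Λ c hsum => ?_
  by_contra! hcne
  obtain ⟨s₁, hs₁, hc₁⟩ := hcne
  set Λ' := Λ.filter fun s => c s ≠ 0 with hΛ'
  obtain ⟨s₀, hs₀, hmin⟩ := Λ'.exists_min_image
    (fun s => toLex ((s.1 : ℝ), -s.2)) ⟨s₁, by simp [hΛ', hs₁, hc₁]⟩
  have hsum' : ∑ s ∈ Λ', c s • waveletAtom φ s = 0 := by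
    rw [← hsum]
    refine Finset.sum_subset (Finset.filter_subset _ _) fun i hi hi' => ?_
    have : c i = 0 := by simpa [hΛ', hi] using hi'
    rw [this, zero_smul]
  have hae := (sum_smul_Lp_eq_zero_iff Λ' c fun s _ => waveletAtom_coeFn h s).1 hsum'
  let L : Set.Ioi (0 : ℝ) × ℝ → Polynomial ℂ := fun s =>
    Polynomial.C ((s.1 : ℝ) : ℂ) * Polynomial.X - Polynomial.C (s.2 : ℂ)
  -- This is the numerator of the relation over the product of all denominators. It vanishes on the
  -- real line, hence identically, and so may be evaluated at a complex pole.
  set N : Polynomial ℂ := ∑ s ∈ Λ', Polynomial.C (c s) * (p'.comp (L s)) *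
    ∏ t ∈ Λ'.erase s, q'.comp (L t) with hN
  have hNeval : ∀ y, N.eval y = ∑ s ∈ Λ', c s * p'.eval ((s.1 : ℝ) * y - s.2) *
      ∏ t ∈ Λ'.erase s, q'.eval ((t.1 : ℝ) * y - t.2) := by
    intro y
    simp [hN, L, Polynomial.eval_finsetSum, Polynomial.eval_prod]
  have hN0 : N = 0 := by
    have hev : (fun x : ℝ => N.eval (x : ℂ)) = fun _ => 0 := by
      refine (Continuous.ae_eq_iff_eq volume (by fun_prop) continuous_const).1 ?_
      filter_upwards [hae] with x hx
      have hqx : ∀ t : Set.Ioi (0 : ℝ) × ℝ, q'.eval (((t.1 : ℝ) : ℂ) * x - t.2) ≠ 0 := by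
        intro t
        have := hreal ((t.1 : ℝ) * x - t.2)
        push_cast at this
        exact this
      rw [hNeval, ← mul_zero (∏ t ∈ Λ', q'.eval (((t.1 : ℝ) : ℂ) * x - t.2)), ← hx,
        Finset.mul_sum]
      refine Finset.sum_congr rfl fun s hs => ?_
      rw [← Finset.mul_prod_erase _ _ hs]
      push_cast
      have := hqx s
      field_simp
    refine N.eq_zero_of_infinite_isRoot ((Set.infinite_range_of_injective
      Complex.ofReal_injective).mono ?_)
    rintro _ ⟨x, rfl⟩
    exact congrFun hev x
  have hr₀ : (0 : ℝ) < s₀.1 := s₀.1.2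
  have hr₀' : ((s₀.1 : ℝ) : ℂ) ≠ 0 := by exact_mod_cast hr₀.ne'
  set y : ℂ := (z + s₀.2) / (s₀.1 : ℝ) with hy
  have hy₀ : ((s₀.1 : ℝ) : ℂ) * y - s₀.2 = z := by rw [hy]; field_simp; ring
  have hother : ∀ t ∈ Λ'.erase s₀, q'.eval (((t.1 : ℝ) : ℂ) * y - t.2) ≠ 0 := by
    intro t ht h0
    obtain ⟨hts, ht⟩ := Finset.mem_erase.1 ht
    have hm := hmin t ht
    rw [Prod.Lex.toLex_le_toLex] at hm
    have hyim : y.im = z.im / s₀.1 := by rw [hy, Complex.div_ofReal_im]; simp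
    have hyre : y.re = (z.re + s₀.2) / s₀.1 := by rw [hy, Complex.div_ofReal_re]; simp
    have him : (((t.1 : ℝ) : ℂ) * y - t.2).im = t.1 * (z.im / s₀.1) := by simp [hyim]
    have hre : (((t.1 : ℝ) : ℂ) * y - t.2).re = t.1 * ((z.re + s₀.2) / s₀.1) - t.2 := by
      simp [hyre]
    have ht0 : (0 : ℝ) < t.1 := t.1.2
    have habs : |(((t.1 : ℝ) : ℂ) * y - t.2).im| = t.1 / s₀.1 * |z.im| := by
      rw [him, abs_mul, abs_div, abs_of_pos ht0, abs_of_pos hr₀]; ring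
    have hle : (t.1 : ℝ) ≤ s₀.1 := by
      have : (t.1 : ℝ) / s₀.1 * |z.im| ≤ |z.im| := by
        rw [← habs]
        rcases hzmax' _ h0 with h1 | h1
        exacts [h1.le, h1.1.le]
      rw [← div_le_one hr₀]
      exact le_of_mul_le_mul_right (by rwa [one_mul]) hzim
    simp only at hm
    rcases hm with hm | ⟨hm1, hm2⟩
    · exact absurd hm (not_lt.2 hle)
    rcases hzmax' _ h0 with h1 | ⟨-, h1⟩
    · rw [habs, ← hm1, div_self hr₀.ne', one_mul] at h1
      exact lt_irrefl _ h1
    · rw [hre, ← hm1, mul_div_cancel₀ _ hr₀.ne'] at h1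
      refine hts (Prod.ext (Subtype.ext hm1.symm) ?_)
      linarith
  have hfin := hNeval y
  rw [hN0, Polynomial.eval_zero, ← Finset.add_sum_erase _ _ hs₀, Finset.sum_eq_zero, add_zero,
    hy₀] at hfin
  · have h1 : c s₀ ≠ 0 := (Finset.mem_filter.1 hs₀).2
    exact mul_ne_zero (mul_ne_zero h1 (hroot z hz0)) (Finset.prod_ne_zero_iff.2 hother) hfin.symm
  · intro s hs
    obtain ⟨hss, hs⟩ := Finset.mem_erase.1 hs
    rw [Finset.prod_eq_zero (Finset.mem_erase.2 ⟨hss.symm, hs₀⟩) (by rw [hy₀, hz0]), mul_zero]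

/-! ### Two-sided exponentials and the Gaussian -/

/-- An integrable function whose Fourier transform is a square-integrable even
logarithmico-exponential function generates independent wavelet systems. -/
theorem finiteWaveletSystemsIndependent_of_fourier_eq {f : ℝ → ℂ} (hf : Integrable f)
    (hf2 : MemLp f 2 volume) (hf0 : ¬ f =ᵐ[volume] 0) {g : ℝ → ℝ} (hg : MemLp g 2 volume)
    (hLE : IsLogExp g) (heven : ∀ x, g (-x) = g x) (hfg : 𝓕 f = fun x => (g x : ℂ)) :
    FiniteWaveletSystemsIndependent (hf2.toLp f) := by
  refine IsLECombination.finiteWaveletSystemsIndependent (fun h => hf0 ?_) ?_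
  · exact hf2.coeFn_toLp.symm.trans ((Lp.eq_zero_iff_ae_eq_zero).1 h)
  · have hF : MemLp (𝓕 f) 2 volume := by rw [hfg]; exact hg.ofReal
    rw [fourier_toLp_eq hf hf2 hF]
    refine ⟨1, fun _ => 1, fun _ => g, fun _ => ⟨hg, ⟨g, hLE, .rfl⟩, ⟨g, hLE, ?_⟩⟩, ?_⟩
    · simp_rw [heven]; exact .rfl
    · refine hF.coeFn_toLp.trans ?_
      rw [hfg]
      simp [Filter.EventuallyEq]

theorem not_ae_eq_zero_of_forall_ne {f : ℝ → ℂ} (hf : ∀ x, f x ≠ 0) : ¬ f =ᵐ[volume] 0 := by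
  intro h
  obtain ⟨x, hx⟩ := h.exists
  exact hf x hx

/-- The bound `‖f‖² ≤ C ‖f‖` reduces square-integrability to integrability. -/
theorem memLp_two_of_integrable_of_bounded {E : Type*} [NormedAddCommGroup E] {f : ℝ → E}
    (hf : Integrable f) {C : ℝ} (hC : ∀ x, ‖f x‖ ≤ C) : MemLp f 2 volume := by
  rw [memLp_two_iff_integrable_sq_norm hf.1]
  refine (hf.norm.const_mul C).mono' (hf.1.norm.pow 2) (.of_forall fun x => ?_)
  rw [Real.norm_of_nonneg (by positivity), sq]
  exact mul_le_mul_of_nonneg_right (hC x) (norm_nonneg _)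

/-- The two half-lines contribute `1 / (a - iy)` and `1 / (a + iy)`. -/
theorem integrable_and_integral_cexp_mul_exp_neg_abs {a : ℝ} (ha : 0 < a) (y : ℝ) :
    Integrable (fun x : ℝ => Complex.exp (y * x * Complex.I) * (Real.exp (-(a * |x|)) : ℂ)) ∧
    ∫ x : ℝ, Complex.exp (y * x * Complex.I) * (Real.exp (-(a * |x|)) : ℂ) =
      ((2 * a / (a ^ 2 + y ^ 2) : ℝ) : ℂ) := by
  set f : ℝ → ℂ := fun x => Complex.exp (y * x * Complex.I) * (Real.exp (-(a * |x|)) : ℂ) with hf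
  have key : ∀ w : ℝ, IntegrableOn (fun x : ℝ => Complex.exp ((-a + w * Complex.I) * x))
      (Set.Ioi 0) := fun w => integrableOn_exp_mul_complex_Ioi (by simpa using ha) 0
  have hval : ∀ w : ℝ, ∫ x in Set.Ioi (0 : ℝ), Complex.exp ((-a + w * Complex.I) * x) =
      -1 / (-a + w * Complex.I) := fun w => by
    rw [integral_exp_mul_complex_Ioi (by simpa using ha)]; simp
  have h1 : Set.EqOn f (fun x : ℝ => Complex.exp ((-a + y * Complex.I) * x)) (Set.Ioi 0) := by
    intro x hx
    simp only [hf, Complex.ofReal_exp, ← Complex.exp_add, abs_of_pos (Set.mem_Ioi.1 hx)]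
    congr 1; push_cast; ring
  have h2 : Set.EqOn (fun x => f (-x))
      (fun x : ℝ => Complex.exp ((-a + (-y : ℝ) * Complex.I) * x)) (Set.Ioi 0) := by
    intro x hx
    simp only [hf, Complex.ofReal_exp, ← Complex.exp_add, abs_neg, abs_of_pos (Set.mem_Ioi.1 hx)]
    congr 1; push_cast; ring
  have hi1 : IntegrableOn f (Set.Ioi 0) := (key y).congr_fun h1.symm measurableSet_Ioi
  have hi2 : IntegrableOn f (Set.Iic 0) := by
    have := (key (-y)).congr_fun h2.symm measurableSet_Ioi
    rw [integrableOn_Iic_iff_integrableOn_Iio]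
    simpa only [neg_neg, Set.neg_Ioi, neg_zero] using this.comp_neg
  have h3 : ∫ x in Set.Iic (0 : ℝ), f x = ∫ x in Set.Ioi (0 : ℝ), f (-x) := by
    rw [integral_comp_neg_Ioi, neg_zero]
  refine ⟨by simpa only [Set.Iic_union_Ioi, integrableOn_univ] using hi2.union hi1, ?_⟩
  rw [← intervalIntegral.integral_Iic_add_Ioi hi2 hi1, h3, setIntegral_congr_fun measurableSet_Ioi h1,
    setIntegral_congr_fun measurableSet_Ioi h2, hval, hval]
  have e1 : (-a + y * Complex.I : ℂ) ≠ 0 := fun h => by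
    have := congrArg Complex.re h; simp at this; exact ha.ne' this
  have e2 : (-a + (-y : ℝ) * Complex.I : ℂ) ≠ 0 := fun h => by
    have := congrArg Complex.re h; simp at this; exact ha.ne' this
  have e3 : ((a : ℂ) ^ 2 + (y : ℂ) ^ 2) ≠ 0 := by
    have : a ^ 2 + y ^ 2 ≠ 0 := by positivity
    exact_mod_cast this
  push_cast at e2 ⊢
  rw [div_add_div _ _ e2 e1, div_eq_div_iff (mul_ne_zero e2 e1) e3]
  linear_combination (2 * (a : ℂ) * y ^ 2) * Complex.I_sq

theorem integrable_exp_neg_mul_abs {a : ℝ} (ha : 0 < a) :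
    Integrable fun x : ℝ => (Real.exp (-(a * |x|)) : ℂ) := by
  simpa using (integrable_and_integral_cexp_mul_exp_neg_abs ha 0).1

theorem fourier_exp_neg_mul_abs {a : ℝ} (ha : 0 < a) :
    𝓕 (fun x : ℝ => (Real.exp (-(a * |x|)) : ℂ)) =
      fun γ : ℝ => ((2 * a / (a ^ 2 + (2 * Real.pi * γ) ^ 2) : ℝ) : ℂ) := by
  ext γ
  rw [Real.fourier_eq']
  have h := (integrable_and_integral_cexp_mul_exp_neg_abs ha (-2 * Real.pi * γ)).2
  rw [show (2 * Real.pi * γ) ^ 2 = (-2 * Real.pi * γ) ^ 2 by ring, ← h]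
  congr 1
  ext x
  simp only [RCLike.inner_apply, conj_trivial, smul_eq_mul]
  congr 3
  push_cast; ring

theorem memLp_div_sq_add_sq {a : ℝ} (ha : 0 < a) :
    MemLp (fun γ : ℝ => 2 * a / (a ^ 2 + (2 * Real.pi * γ) ^ 2)) 2 volume := by
  have h1 : Integrable fun γ : ℝ => 2 * a / (a ^ 2 + (2 * Real.pi * γ) ^ 2) := by
    have h := ((integrable_inv_one_add_sq.comp_mul_left' (R := 2 * Real.pi / a)
      (by positivity)).const_mul (2 / a))
    refine h.congr (.of_forall fun γ => ?_)
    simp only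
    field_simp
  refine memLp_two_of_integrable_of_bounded h1 (C := 2 * a / a ^ 2) fun γ => ?_
  rw [Real.norm_of_nonneg (by positivity)]
  gcongr
  nlinarith [sq_nonneg (2 * Real.pi * γ)]

theorem finiteWaveletSystemsIndependent_exp_neg_mul_abs {a : ℝ} (ha : 0 < a) :
    ∃ h : MemLp (fun x : ℝ => (Real.exp (-(a * |x|)) : ℂ)) 2 volume,
      FiniteWaveletSystemsIndependent (h.toLp _) := by
  have h : MemLp (fun x : ℝ => (Real.exp (-(a * |x|)) : ℂ)) 2 volume := by
    refine memLp_two_of_integrable_of_bounded (integrable_exp_neg_mul_abs ha) (C := 1) fun x => ?_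
    rw [Complex.norm_real, Real.norm_eq_abs, Real.abs_exp, Real.exp_le_one_iff]
    exact neg_nonpos.2 (by positivity)
  refine ⟨h, finiteWaveletSystemsIndependent_of_fourier_eq (integrable_exp_neg_mul_abs ha) h
    (not_ae_eq_zero_of_forall_ne fun x => by exact_mod_cast (Real.exp_pos _).ne')
    (memLp_div_sq_add_sq ha) ?_ (fun x => by ring_nf) (fourier_exp_neg_mul_abs ha)⟩
  refine .div (.const _) (.add (.const _) ?_) (.of_forall fun x => by positivity)
  have hl : IsLogExp fun x => 2 * Real.pi * x := .mul (.const _) .id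
  simpa only [sq] using hl.mul hl

theorem fourier_exp_neg_sq :
    𝓕 (fun x : ℝ => (Real.exp (-x ^ 2) : ℂ)) =
      fun γ : ℝ => ((√Real.pi * Real.exp (-Real.pi ^ 2 * γ ^ 2) : ℝ) : ℂ) := by
  have hpi : (Real.pi : ℂ) ≠ 0 := by exact_mod_cast Real.pi_ne_zero
  -- The parameter `1 / π` turns `exp (-π b x²)` into `exp (-x²)`.
  have h := fourier_gaussian_pi (b := ((Real.pi⁻¹ : ℝ) : ℂ)) (by simpa using Real.pi_pos)
  convert! h using 1
  · congr 1
    ext x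
    push_cast
    congr 1
    field_simp
  · ext γ
    have h1 : (((Real.pi⁻¹ : ℝ) : ℂ) ^ (1 / 2 : ℂ)) = ((√Real.pi)⁻¹ : ℝ) := by
      rw [show (1 / 2 : ℂ) = ((1 / 2 : ℝ) : ℂ) by push_cast; rfl,
        ← Complex.ofReal_cpow (inv_nonneg.2 Real.pi_pos.le), ← Real.sqrt_eq_rpow, Real.sqrt_inv]
    rw [h1]
    push_cast
    rw [one_div, inv_inv]
    congr 2
    field_simp

theorem finiteWaveletSystemsIndependent_exp_neg_sq :
    ∃ h : MemLp (fun x : ℝ => (Real.exp (-x ^ 2) : ℂ)) 2 volume,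
      FiniteWaveletSystemsIndependent (h.toLp _) := by
  have hi : Integrable fun x : ℝ => (Real.exp (-x ^ 2) : ℂ) := by
    simpa using (integrable_exp_neg_mul_sq one_pos).ofReal (𝕜 := ℂ)
  have h : MemLp (fun x : ℝ => (Real.exp (-x ^ 2) : ℂ)) 2 volume := by
    refine memLp_two_of_integrable_of_bounded hi (C := 1) fun x => ?_
    rw [Complex.norm_real, Real.norm_eq_abs, Real.abs_exp, Real.exp_le_one_iff]
    exact neg_nonpos.2 (by positivity)
  have hg : MemLp (fun γ : ℝ => √Real.pi * Real.exp (-Real.pi ^ 2 * γ ^ 2)) 2 volume := by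
    refine memLp_two_of_integrable_of_bounded
      ((integrable_exp_neg_mul_sq (by positivity)).const_mul _) (C := √Real.pi) fun x => ?_
    rw [Real.norm_of_nonneg (by positivity)]
    refine mul_le_of_le_one_right (by positivity) (Real.exp_le_one_iff.2 ?_)
    rw [neg_mul]
    exact neg_nonpos.2 (by positivity)
  refine ⟨h, finiteWaveletSystemsIndependent_of_fourier_eq hi h
    (not_ae_eq_zero_of_forall_ne fun x => by exact_mod_cast (Real.exp_pos _).ne')
    hg ?_ (fun x => by ring_nf) fourier_exp_neg_sq⟩
  have hl : IsLogExp fun x => x ^ 2 := by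
    simpa only [sq] using IsLogExp.mul .id .id
  exact IsLogExp.mul (.const √Real.pi) (.exp (.mul (.const (-Real.pi ^ 2)) hl))

theorem theorem4p2 :
    (∀ φ : Lp ℂ 2 (volume : Measure ℝ), φ ≠ 0 →
      IsLECombination (𝓕 φ : Lp ℂ 2 (volume : Measure ℝ)) →
      FiniteWaveletSystemsIndependent φ) ∧
    (∀ (φ : Lp ℂ 2 (volume : Measure ℝ)) (p q : Polynomial ℂ), φ ≠ 0 →
      (φ =ᵐ[volume] fun x : ℝ => p.eval (x : ℂ) / q.eval (x : ℂ)) →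
      FiniteWaveletSystemsIndependent φ) ∧
    (∀ n : ℕ, 0 < n →
      ∃ h : MemLp (fun x : ℝ => ((Real.exp (-((n : ℝ) * |x|)) : ℝ) : ℂ)) 2 volume,
        FiniteWaveletSystemsIndependent (h.toLp _)) ∧
    (∃ h : MemLp (fun x : ℝ => ((Real.exp (-x ^ 2) : ℝ) : ℂ)) 2 volume,
      FiniteWaveletSystemsIndependent (h.toLp _)) :=
  ⟨fun _ hφ h => h.finiteWaveletSystemsIndependent hφ,
    fun _ _ _ hφ h => finiteWaveletSystemsIndependent_of_rational hφ h,
    fun _ hn => finiteWaveletSystemsIndependent_exp_neg_mul_abs (Nat.cast_pos.2 hn),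
    finiteWaveletSystemsIndependent_exp_neg_sq⟩
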